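/- Let $I$ be a finite set and $\Omega=(\Omega_{ij})_{i,j\in I}$ an integer matrix with $\Omega_{ii}>0$, $\Omega_{ij}\le 0$ and $(\Omega_{ij}+\Omega_{ji})/\Omega_{ii}\in\mathbb Z_{\le 0}$ for $i\ne j$, and $\gcd_i\Omega_{ii}=1$. On $\mathbb Z[I]$ let $\langle\,,\rangle$ be the bilinear form with $\langle i,j\rangle=\Omega_{ij}$, let $\lambda\cdot\mu=\langle\lambda,\mu\rangle+\langle\mu,\lambda\rangle$, and put $\{\lambda,\mu\}=v^{\lambda\cdot\mu}t^{\langle\mu,\lambda\rangle-\langle\lambda,\mu\rangle}$, $v_i=v^{i\cdot i/2}$, $t_i=t^{i\cdot i/2}$, $[n]_{v,t}=\frac{(vt)^n-(vt^{-1})^{-n}}{vt-(vt^{-1})^{-1}}$, $[n]^!_{v,t}=\prod_{k=1}^n[k]_{v,t}$, $x_i^{(n)}=x_i^n/[n]^!_{v_i,t_i}$. Let $U=U_{v,t}$ be the $\mathbb Q(v,t)$-algebra generated by $E_i,F_i,K_i^{\pm1},K_i'^{\pm1}$ $(i\in I)$ subject to: the $K_i,K'_i$ commute with each other and $K_i^{\pm1}K_i^{\mp1}=K_i'^{\pm1}K_i'^{\mp1}=1$;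 $K_iE_jK_i^{-1}=v^{i\cdot j}t^{\langle j,i\rangle-\langle i,j\rangle}E_j$, $K'_iE_jK_i'^{-1}=v^{-i\cdot j}t^{\langle j,i\rangle-\langle i,j\rangle}E_j$, $K'_iF_jK_i'^{-1}=v^{i\cdot j}t^{\langle i,j\rangle-\langle j,i\rangle}F_j$, $K_iF_jK_i^{-1}=v^{-i\cdot j}t^{\langle i,j\rangle-\langle j,i\rangle}F_j$; $E_iF_j-F_jE_i=\delta_{ij}\frac{K_i-K'_i}{v_i-v_i^{-1}}$; and, for $i\neq j$, with the sums over $p+p'=1-2\frac{i\cdot j}{i\cdot i}$, $\sum(-1)^pt_i^{-p(p'-2\frac{\langle i,j\rangle}{i\cdot i}+2\frac{\langle j,i\rangle}{i\cdot i})}E_i^{(p)}E_jE_i^{(p')}=0$ and $\sum(-1)^pt_i^{-p(p'-2\frac{\langle i,j\rangle}{i\cdot i}+2\frac{\langle j,i\rangle}{i\cdot i})}F_i^{(p')}F_jF_i^{(p)}=0$. It has the comultiplication $\Delta(K_i)=K_i\otimes K_i$, $\Delta(K'_i)=K'_i\otimes K'_i$, $\Delta(E_i)=E_i\otimes1+K_i\otimes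 E_i$, $\Delta(F_i)=1\otimes F_i+F_i\otimes K'_i$ and the counit $\varepsilon(K_i)=\varepsilon(K_i')=1$, $\varepsilon(E_i)=\varepsilon(F_i)=0$; $U$ acts on tensor products of modules through $\Delta$. For $\nu\in\mathbb N[I]$ let $U^+_\nu$ (resp. $U^-_{-\nu}$) be the span of the monomials in the $E_i$ (resp. $F_i$) of degree $\nu$, and for $\mu\in\mathbb Z[I]$ let $K_\mu=\prod K_i^{\mu_i}$, $K'_\mu=\prod K_i'^{\mu_i}$. Let $(\,,)_\phi$ be the skew-Hopf pairing between the subalgebras $U_{\ge0}=\langle E_i,K_i^{\pm1}\rangle$ and $U_{\le0}=\langle F_i,K_i'^{\pm1}\rangle$ (so $(1,y)_\phi=\varepsilon(y)$, $(x,1)_\phi=\varepsilon(x)$, $(x,yy')_\phi=(\Delta(x),y\otimes y')_\phi$, $(xx',y)_\phi=(x\otimes x',\Delta^{op}(y))_\phi$) with $(E_i,F_j)_\phi=\delta_{ij}(v_i^{-1}-v_i)^{-1}$ and $(K_\mu x,K'_\nu y)_\phi=\{\mu,\nu\}\{\mu,\beta\}\{\alpha,\nu\}(x,y)_\phi$ for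 $x\in U^+_\alpha$, $y\in U^-_{-\beta}$. Choose for each $\nu\in\mathbb N[I]$ a basis $\mathbf B_\nu$ of $U^-_{-\nu}$, let $\{b^*\}_{b\in\mathbf B_\nu}$ be the basis of $U^+_\nu$ dual to it under $(\,,)_\phi$, and put $\Theta_\nu=\sum_{b\in\mathbf B_\nu}b\otimes b^*$ and $f(\lambda,\mu)=(K_\lambda,K'_\mu)_\phi^{-1}$ for $\lambda,\mu\in\mathbb Z[I]$. A $U$-module $M$ is a weight module if $M=\bigoplus_{\lambda\in\mathbb Z[I]}M_\lambda$, where $M_\lambda=\{m: K_im=v^{i\cdot\lambda}c_{i,\lambda}m,\ K'_im=v^{-i\cdot\lambda}c_{i,\lambda}m\ \ \forall i\in I\}$ and $c_{i,\lambda}=t^{\langle\lambda,i\rangle-\langle i,\lambda\rangle}$. Let $M$, $M'$ be finite-dimensional weight modules of $U$. Let $P:M\otimes M'\to M'\otimes M$ be the flip, let $\tilde f:M'\otimes M\to M'\otimes M$ be the linear map with $\tilde f(m'\otimes m)=f(\lambda,\mu)\,m'\otimes m$ for $m'\in M'_\lambda$, $m\in M_\mu$. Then only finitely many $\Theta_\nu$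 act on $M'\otimes M$ by a non-zero operator, so that $\Theta=\sum_\nu\Theta_\nu$ is a well-defined operator on $M'\otimes M$, and $$\mathcal R_{M,M'}=\Theta\circ\tilde f\circ P:\ M\otimes M'\to M'\otimes M$$ is an isomorphism of $U$-modules. -/

import Mathlib

open scoped TensorProduct

noncomputable section

namespace TwoParam

/-- The ground field `ℚ(v,t)`. -/
def Qvt : Type := FractionRing (MvPolynomial (Fin 2) ℚ)

instance : Field Qvt := inferInstanceAs (Field (FractionRing (MvPolynomial (Fin 2) ℚ)))

def v : Qvt := algebraMap (MvPolynomial (Fin 2) ℚ) (FractionRing (MvPolynomial (Fin 2) ℚ)) (MvPolynomial.X 0)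

def t : Qvt := algebraMap (MvPolynomial (Fin 2) ℚ) (FractionRing (MvPolynomial (Fin 2) ℚ)) (MvPolynomial.X 1)

theorem v_ne_zero : v ≠ 0 := by
  intro h
  exact MvPolynomial.X_ne_zero (R := ℚ) (0 : Fin 2)
    ((IsFractionRing.injective (MvPolynomial (Fin 2) ℚ)
      (FractionRing (MvPolynomial (Fin 2) ℚ))) (h.trans (map_zero _).symm))

theorem t_ne_zero : t ≠ 0 := by
  intro h
  exact MvPolynomial.X_ne_zero (R := ℚ) (1 : Fin 2)
    ((IsFractionRing.injective (MvPolynomial (Fin 2) ℚ)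
      (FractionRing (MvPolynomial (Fin 2) ℚ))) (h.trans (map_zero _).symm))

theorem v_pow_ne_one {n : ℕ} (hn : n ≠ 0) : v ^ n ≠ 1 := by
  intro h
  have h1 : (MvPolynomial.X 0 : MvPolynomial (Fin 2) ℚ) ^ n = 1 := by
    apply IsFractionRing.injective (MvPolynomial (Fin 2) ℚ)
      (FractionRing (MvPolynomial (Fin 2) ℚ))
    rw [map_pow, map_one]
    exact h
  have h2 := congrArg (MvPolynomial.eval (fun _ => (0 : ℚ))) h1
  simp [hn] at h2

/-- `[n]_{v,t}` at parameters `x`, `y`. -/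
def qint (x y : Qvt) (n : ℕ) : Qvt :=
  ((x * y) ^ n - ((x * y⁻¹) ^ n)⁻¹) / (x * y - (x * y⁻¹)⁻¹)

/-- `[n]^!_{v,t}` at parameters `x`, `y`. -/
def qfact (x y : Qvt) (n : ℕ) : Qvt := ∏ k ∈ Finset.Icc 1 n, qint x y k

section QAd

variable {A : Type*} [Ring A] [Algebra Qvt A]

/-- Iterated twisted commutator `Y ↦ Y X - α_m X Y`; used to show that `Δ` respects the Serre
relations. -/
def qad (α : ℕ → Qvt) (X Y : A) : ℕ → A
  | 0 => Y
  | m + 1 => qad α X Y m * X - α m • (X * qad α X Y m)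

theorem qad_add (α : ℕ → Qvt) (X Y Y' : A) (m : ℕ) :
    qad α X (Y + Y') m = qad α X Y m + qad α X Y' m := by
  induction m with
  | zero => rfl
  | succ m ih => simp only [qad, ih, add_mul, mul_add, smul_add]; abel

open Polynomial in
def qpoly (α : ℕ → Qvt) (n : ℕ) : Polynomial Qvt :=
  ∏ k ∈ Finset.range n, (1 - C (α k) * X)

theorem qpoly_natDegree (α : ℕ → Qvt) (n : ℕ) : (qpoly α n).natDegree ≤ n := by
  induction n with
  | zero => simp [qpoly]
  | succ n ih =>
    rw [qpoly, Finset.prod_range_succ]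
    refine Polynomial.natDegree_mul_le.trans (Nat.add_le_add ih ?_)
    compute_degree

theorem qpoly_coeff_succ (α : ℕ → Qvt) (n p : ℕ) :
    (qpoly α (n + 1)).coeff (p + 1) = (qpoly α n).coeff (p + 1) - α n * (qpoly α n).coeff p := by
  rw [qpoly, Finset.prod_range_succ, ← qpoly, mul_sub, mul_one, Polynomial.coeff_sub,
    mul_comm (Polynomial.C _), ← mul_assoc, Polynomial.coeff_mul_C, Polynomial.coeff_mul_X, mul_comm]

theorem qpoly_coeff_zero (α : ℕ → Qvt) (n : ℕ) : (qpoly α n).coeff 0 = 1 := by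
  induction n with
  | zero => simp [qpoly]
  | succ n ih => 
    rw [qpoly, Finset.prod_range_succ, ← qpoly, Polynomial.mul_coeff_zero, ih]
    simp

theorem qad_eq (α : ℕ → Qvt) (X Y : A) (n : ℕ) :
    qad α X Y n = ∑ p ∈ Finset.range (n + 1), (qpoly α n).coeff p • (X ^ p * Y * X ^ (n - p)) := by
  induction n with
  | zero => simp [qad, qpoly]
  | succ n ih =>
    have hz : (qpoly α n).coeff (n + 1) = 0 :=
      Polynomial.coeff_eq_zero_of_natDegree_lt (Nat.lt_succ_of_le (qpoly_natDegree α n))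
    have h1 : qad α X Y n * X = ∑ p ∈ Finset.range (n + 1 + 1),
        (qpoly α n).coeff p • (X ^ p * Y * X ^ (n + 1 - p)) := by
      rw [Finset.sum_range_succ _ (n + 1), hz, zero_smul, add_zero, ih, Finset.sum_mul]
      refine Finset.sum_congr rfl fun p hp => ?_
      have : n + 1 - p = (n - p) + 1 := by have := Finset.mem_range.1 hp; omega
      rw [this, pow_succ, smul_mul_assoc, ← mul_assoc]
    have h2 : α n • (X * qad α X Y n) = ∑ p ∈ Finset.range (n + 1),
        (α n * (qpoly α n).coeff p) • (X ^ (p + 1) * Y * X ^ (n + 1 - (p + 1))) := by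
      rw [ih, Finset.mul_sum, Finset.smul_sum]
      refine Finset.sum_congr rfl fun p hp => ?_
      rw [Nat.add_sub_add_right, mul_smul_comm, smul_smul, pow_succ', mul_assoc X, mul_assoc X]
    rw [qad, h1, h2, Finset.sum_range_succ' _ (n + 1), Finset.sum_range_succ' _ (n + 1),
      qpoly_coeff_zero, qpoly_coeff_zero, add_sub_right_comm, ← Finset.sum_sub_distrib]
    congr 1
    refine Finset.sum_congr rfl fun p _ => ?_
    rw [← sub_smul, qpoly_coeff_succ]

end QAd

def qbin (q : Qvt) : ℕ → ℕ → Qvt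
  | _, 0 => 1
  | 0, _ + 1 => 0
  | n + 1, p + 1 => (q ^ (p + 1))⁻¹ * qbin q n (p + 1) + q ^ ((n : ℤ) - p) * qbin q n p

theorem qbin_eq_zero (q : Qvt) (n p : ℕ) (h : n < p) : qbin q n p = 0 := by
  induction n generalizing p with
  | zero => obtain ⟨p, rfl⟩ := Nat.exists_eq_succ_of_ne_zero (by omega : p ≠ 0); rfl
  | succ n ih =>
    obtain ⟨p, rfl⟩ := Nat.exists_eq_succ_of_ne_zero (by omega : p ≠ 0)
    simp only [qbin]
    rw [ih _ (by omega), ih _ (by omega)]; simp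

def qnum (q : Qvt) (n : ℕ) : Qvt := q ^ n - (q ^ n)⁻¹

def qnumfact (q : Qvt) (n : ℕ) : Qvt := ∏ k ∈ Finset.range n, qnum q (k + 1)

theorem qbin_fact (q : Qvt) (hq : q ≠ 0) (a b : ℕ) :
    qbin q (a + b) a * (qnumfact q a * qnumfact q b) = qnumfact q (a + b) := by
  induction a generalizing b with
  | zero => simp [qbin, qnumfact]
  | succ a iha =>
    induction b with
    | zero =>
      have h := iha 0
      simp only [qnumfact, Finset.range_zero, Finset.prod_empty, mul_one, add_zero] at h ⊢
      rw [qbin, qbin_eq_zero q a (a + 1) (by omega), Finset.prod_range_succ, ← h]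
      simp only [mul_zero, zero_add, sub_self, zpow_zero, one_mul]
      rw [← mul_assoc, h, h]
    | succ b ihb =>
      have h1 := iha (b + 1)
      have e1 : a + 1 + (b + 1) = (a + b + 1) + 1 := by ring
      have e2 : a + 1 + b = a + b + 1 := by ring
      have e3 : a + (b + 1) = a + b + 1 := by ring
      rw [e2] at ihb
      rw [e3] at h1
      have s : ∀ n, qnumfact q (n + 1) = qnumfact q n * qnum q (n + 1) := fun n =>
        Finset.prod_range_succ _ _
      rw [e1, qbin, s (a + b + 1)]
      have e4 : q ^ (((a + b + 1 : ℕ) : ℤ) - (a : ℕ)) = q ^ (b + 1) := by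
        rw [← zpow_natCast]; congr 1; push_cast; ring
      rw [e4]
      have key : (q ^ (a + 1))⁻¹ * qnum q (b + 1) + q ^ (b + 1) * qnum q (a + 1)
          = qnum q (a + b + 1 + 1) := by
        have : q ^ (a + b + 1 + 1) = q ^ (a + 1) * q ^ (b + 1) := by ring
        rw [qnum, qnum, qnum, this]
        field_simp
        ring
      rw [← key, mul_add (qnumfact q (a + b + 1))]
      nth_rewrite 1 [← ihb]
      rw [← h1, s a, s b]
      ring

theorem qpoly_coeff (q : Qvt) (hq : q ≠ 0) (n p : ℕ) (τ : Qvt) :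
    (qpoly (fun k => τ * q ^ (2 * (k : ℤ) - n + 1)) n).coeff p = (-1) ^ p * τ ^ p * qbin q n p := by
  induction n generalizing p τ with
  | zero => cases p with
    | zero => simp [qpoly, qbin]
    | succ p => simp [qpoly, qbin, Polynomial.coeff_one]
  | succ n ih =>
    cases p with
    | zero => simp [qpoly_coeff_zero, qbin]
    | succ p =>
      have e : qpoly (fun k => τ * q ^ (2 * (k : ℤ) - (n + 1 : ℕ) + 1)) n
          = qpoly (fun k => (τ * q⁻¹) * q ^ (2 * (k : ℤ) - n + 1)) n := by
        congr 1; funext k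
        rw [mul_assoc]; congr 1
        rw [← zpow_neg_one, ← zpow_add₀ hq]; congr 1; push_cast; ring
      rw [qpoly_coeff_succ, e, ih, ih, qbin, pow_succ q, pow_succ τ]
      have e2 : q ^ (2 * (n : ℤ) - (n + 1 : ℕ) + 1) = q ^ p * q ^ ((n : ℤ) - p) := by
        rw [← zpow_natCast q p, ← zpow_add₀ hq]; congr 1; push_cast; ring
      rw [e2, mul_pow, mul_pow, inv_pow, inv_pow, pow_succ q, mul_inv]
      field_simp
      ring


def tri (y : Qvt) (n : ℕ) : Qvt := ∏ k ∈ Finset.range n, y ^ k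

theorem tri_add (y : Qvt) (a b : ℕ) : tri y (a + b) = tri y a * tri y b * y ^ (a * b) := by
  induction b with
  | zero => simp [tri]
  | succ b ih =>
    have s : ∀ n, tri y (n + 1) = tri y n * y ^ n := fun n => Finset.prod_range_succ _ _
    rw [← add_assoc, s, ih, s, pow_add, mul_add, mul_one, pow_add]
    ring

theorem tri_ne_zero (y : Qvt) (hy : y ≠ 0) (n : ℕ) : tri y n ≠ 0 :=
  Finset.prod_ne_zero_iff.2 fun _ _ => pow_ne_zero _ hy

theorem qint_eq (x y : Qvt) (hx : x ≠ 0) (hy : y ≠ 0) (h1 : qnum x 1 ≠ 0) (k : ℕ) :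
    qint x y (k + 1) = y ^ k * qnum x (k + 1) / qnum x 1 := by
  have e : x * y - (x * y⁻¹)⁻¹ = y * qnum x 1 := by
    rw [qnum, pow_one]; field_simp
  have e' : (x * y) ^ (k + 1) - ((x * y⁻¹) ^ (k + 1))⁻¹ = y ^ (k + 1) * qnum x (k + 1) := by
    rw [qnum, mul_pow, mul_pow, inv_pow]; field_simp
  rw [qint, e, e', pow_succ]
  field_simp

theorem qfact_eq (x y : Qvt) (hx : x ≠ 0) (hy : y ≠ 0) (h1 : qnum x 1 ≠ 0) (n : ℕ) :
    qfact x y n = tri y n * qnumfact x n / qnum x 1 ^ n := by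
  induction n with
  | zero => simp [qfact, tri, qnumfact]
  | succ n ih =>
    rw [qfact, Finset.prod_Icc_succ_top (by omega), ← qfact, ih, qint_eq x y hx hy h1,
      show tri y (n + 1) = tri y n * y ^ n from Finset.prod_range_succ _ _,
      show qnumfact x (n + 1) = qnumfact x n * qnum x (n + 1) from Finset.prod_range_succ _ _,
      pow_succ (qnum x 1)]
    field_simp

theorem qnum_ne_zero {d : ℕ} (hd : d ≠ 0) {k : ℕ} (hk : k ≠ 0) : qnum (v ^ d) k ≠ 0 := by
  intro h
  have h0 : (v ^ d) ^ k ≠ 0 := pow_ne_zero _ (pow_ne_zero _ v_ne_zero)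
  rw [qnum, sub_eq_zero] at h
  have h2 : (v ^ d) ^ k * (v ^ d) ^ k = 1 := by
    nth_rewrite 2 [h]; exact mul_inv_cancel₀ h0
  rw [← pow_mul, ← pow_add] at h2
  exact v_pow_ne_one (by positivity) h2

/-- Coefficient comparison: divided-power coefficients against the product expansion. -/
theorem serre_coeff (d : ℕ) (hd : d ≠ 0) (σ : ℤ) (a b : ℕ) :
    (qpoly (fun k => t ^ σ * (v ^ d) ^ (2 * (k : ℤ) - (a + b : ℕ) + 1)) (a + b)).coeff a
      = qfact (v ^ d) (t ^ d) (a + b) * ((-1) ^ a * t ^ (-((a : ℤ) * ((b : ℤ) * d - σ)))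
        * ((qfact (v ^ d) (t ^ d) a)⁻¹ * (qfact (v ^ d) (t ^ d) b)⁻¹)) := by
  have hv : v ^ d ≠ 0 := pow_ne_zero _ v_ne_zero
  have ht : t ^ d ≠ 0 := pow_ne_zero _ t_ne_zero
  have h1 : qnum (v ^ d) 1 ≠ 0 := qnum_ne_zero hd one_ne_zero
  have hf : ∀ n, qnumfact (v ^ d) n ≠ 0 := fun n =>
    Finset.prod_ne_zero_iff.2 fun k _ => qnum_ne_zero hd (by omega)
  have hT := tri_ne_zero _ ht
  rw [qpoly_coeff _ hv, qfact_eq _ _ hv ht h1, qfact_eq _ _ hv ht h1, qfact_eq _ _ hv ht h1,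
    tri_add, ← qbin_fact _ hv a b]
  have e : t ^ (-((a : ℤ) * ((b : ℤ) * d - σ))) = (t ^ σ) ^ a * ((t ^ d) ^ (a * b))⁻¹ := by
    rw [← zpow_natCast, ← zpow_mul, ← zpow_natCast t d, ← zpow_natCast, ← zpow_mul, ← zpow_neg,
      ← zpow_add₀ t_ne_zero]
    congr 1; push_cast; ring
  rw [e]
  have := hf a
  have := hf b
  have := hT a
  have := hT b
  have := pow_ne_zero (a * b) ht
  rw [pow_add (qnum _ _)]
  field_simp

theorem qfact_ne_zero (d : ℕ) (hd : d ≠ 0) (n : ℕ) : qfact (v ^ d) (t ^ d) n ≠ 0 := by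
  have hv : v ^ d ≠ 0 := pow_ne_zero _ v_ne_zero
  have ht : t ^ d ≠ 0 := pow_ne_zero _ t_ne_zero
  have h1 : qnum (v ^ d) 1 ≠ 0 := qnum_ne_zero hd one_ne_zero
  rw [qfact_eq _ _ hv ht h1]
  exact div_ne_zero (mul_ne_zero (tri_ne_zero _ ht n) (Finset.prod_ne_zero_iff.2 fun k _ =>
    qnum_ne_zero hd (by omega))) (pow_ne_zero _ h1)

theorem qpoly_reflect (α : ℕ → Qvt) (n : ℕ) :
    qpoly (fun k => α (n - 1 - k)) n = qpoly α n :=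
  Finset.prod_range_reflect (fun k => 1 - Polynomial.C (α k) * Polynomial.X) n


/-- The integer matrix `Ω`, which determines the Cartan datum `(I, ·)`. -/
structure Datum (I : Type*) [Fintype I] where
  Ω : I → I → ℤ
  diag_pos : ∀ i, 0 < Ω i i
  offdiag_nonpos : ∀ i j, i ≠ j → Ω i j ≤ 0
  integral : ∀ i j, i ≠ j → ∃ a : ℤ, a ≤ 0 ∧ Ω i j + Ω j i = a * Ω i i
  gcd_diag : Finset.univ.gcd (fun i => Ω i i) = 1

variable {I : Type*} [Fintype I] [DecidableEq I]

/-- `⟨λ, μ⟩` on `ℤ[I]`. -/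
def Datum.ang (D : Datum I) (l m : I → ℤ) : ℤ := ∑ i, ∑ j, l i * m j * D.Ω i j

/-- `λ · μ` on `ℤ[I]`. -/
def Datum.dot (D : Datum I) (l m : I → ℤ) : ℤ := D.ang l m + D.ang m l

/-- The basis vector of `ℤ[I]` attached to `i`. -/
def sg (i : I) : I → ℤ := Pi.single i 1

/-- `{λ, μ} = v^{λ·μ} t^{⟨μ,λ⟩-⟨λ,μ⟩}`. -/
def Datum.brace (D : Datum I) (l m : I → ℤ) : Qvt :=
  v ^ D.dot l m * t ^ (D.ang m l - D.ang l m)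

/-- `v_i = v^{i·i/2}`. -/
def Datum.vi (D : Datum I) (i : I) : Qvt := v ^ D.Ω i i

/-- `t_i = t^{i·i/2}`. -/
def Datum.ti (D : Datum I) (i : I) : Qvt := t ^ D.Ω i i

/-- `1 - 2 (i·j)/(i·i)`. -/
def Datum.serreDeg (D : Datum I) (i j : I) : ℕ := (1 - (D.Ω i j + D.Ω j i) / D.Ω i i).toNat

section Serre

variable {A : Type*} [Ring A] [Algebra Qvt A]

/-- Divided power `x^{(p)} = x^p / [p]^!_{v_i,t_i}`. -/
def Datum.divPow (D : Datum I) (i : I) (x : A) (p : ℕ) : A :=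
  (qfact (D.vi i) (D.ti i) p)⁻¹ • x ^ p

/-- `(-1)^p t_i^{-p(p' - 2⟨i,j⟩/(i·i) + 2⟨j,i⟩/(i·i))}`, where `t_i = t^{(i·i)/2}`. -/
def Datum.serreScalar (D : Datum I) (i j : I) (p p' : ℕ) : Qvt :=
  (-1) ^ p * t ^ (-((p : ℤ) * ((p' : ℤ) * D.Ω i i - D.Ω i j + D.Ω j i)))

/-- The left-hand side of the Serre relation for the `E_i`. -/
def Datum.serreE (D : Datum I) (i j : I) (x y : A) : A :=
  ∑ p ∈ Finset.HasAntidiagonal.antidiagonal (D.serreDeg i j),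
    D.serreScalar i j p.1 p.2 • (D.divPow i x p.1 * y * D.divPow i x p.2)

/-- The left-hand side of the Serre relation for the `F_i`. -/
def Datum.serreF (D : Datum I) (i j : I) (x y : A) : A :=
  ∑ p ∈ Finset.HasAntidiagonal.antidiagonal (D.serreDeg i j),
    D.serreScalar i j p.1 p.2 • (D.divPow i x p.2 * y * D.divPow i x p.1)

theorem Datum.exists_nat (D : Datum I) (i : I) : ∃ d : ℕ, d ≠ 0 ∧ D.Ω i i = d := by
  refine ⟨(D.Ω i i).toNat, ?_, ?_⟩ <;> have := D.diag_pos i <;> omega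

theorem Datum.serreDeg_eq (D : Datum I) (i j : I) (h : i ≠ j) :
    D.Ω i j + D.Ω j i = (1 - (D.serreDeg i j : ℤ)) * D.Ω i i := by
  obtain ⟨a, ha, e⟩ := D.integral i j h
  have := D.diag_pos i
  rw [Datum.serreDeg, e, Int.mul_ediv_cancel _ (by omega), Int.toNat_of_nonneg (by omega)]
  ring

/-- The scalars in the factorised form of the Serre element. -/
def Datum.sα (D : Datum I) (i j : I) (k : ℕ) : Qvt :=
  t ^ (D.Ω i j - D.Ω j i) * v ^ (D.Ω i i * (2 * (k : ℤ) - D.serreDeg i j + 1))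

def Datum.sα' (D : Datum I) (i j : I) (k : ℕ) : Qvt :=
  t ^ (D.Ω i j - D.Ω j i) * v ^ (D.Ω i i * (D.serreDeg i j - 1 - 2 * (k : ℤ)))

theorem Datum.qpoly_sα' (D : Datum I) (i j : I) :
    qpoly (D.sα' i j) (D.serreDeg i j) = qpoly (D.sα i j) (D.serreDeg i j) := by
  rw [← qpoly_reflect]
  refine Finset.prod_congr rfl fun k hk => ?_
  have hk := Finset.mem_range.1 hk
  have : D.sα' i j (D.serreDeg i j - 1 - k) = D.sα i j k := by
    rw [Datum.sα', Datum.sα]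
    congr 3
    omega
  exact congrArg (fun c => 1 - Polynomial.C c * Polynomial.X) this

theorem Datum.qpoly_sα_coeff (D : Datum I) (i j : I) (a b : ℕ) (h : a + b = D.serreDeg i j) :
    (qpoly (D.sα i j) (D.serreDeg i j)).coeff a
      = qfact (D.vi i) (D.ti i) (D.serreDeg i j) * (D.serreScalar i j a b *
        ((qfact (D.vi i) (D.ti i) a)⁻¹ * (qfact (D.vi i) (D.ti i) b)⁻¹)) := by
  obtain ⟨d, hd, e⟩ := D.exists_nat i
  have e1 : D.sα i j = fun k : ℕ => t ^ (D.Ω i j - D.Ω j i) *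
      (v ^ d) ^ (2 * (k : ℤ) - (D.serreDeg i j : ℕ) + 1) := by
    funext k
    rw [Datum.sα, e, zpow_mul, zpow_natCast]
  rw [e1, ← h, serre_coeff d hd, Datum.vi, Datum.ti, e, zpow_natCast, zpow_natCast,
    Datum.serreScalar, e]
  congr 4
  ring

theorem Datum.qfact_ne_zero (D : Datum I) (i : I) (n : ℕ) : qfact (D.vi i) (D.ti i) n ≠ 0 := by
  obtain ⟨d, hd, e⟩ := D.exists_nat i
  rw [Datum.vi, Datum.ti, e, zpow_natCast, zpow_natCast]
  exact TwoParam.qfact_ne_zero d hd n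

theorem Datum.qad_sα (D : Datum I) (i j : I) (x y : A) :
    qad (D.sα i j) x y (D.serreDeg i j)
      = qfact (D.vi i) (D.ti i) (D.serreDeg i j) • D.serreE i j x y := by
  rw [qad_eq, Datum.serreE, Finset.Nat.sum_antidiagonal_eq_sum_range_succ_mk, Finset.smul_sum]
  refine Finset.sum_congr rfl fun p hp => ?_
  have hp := Finset.mem_range.1 hp
  rw [D.qpoly_sα_coeff i j p (D.serreDeg i j - p) (by omega)]
  simp only [Datum.divPow, smul_mul_assoc, mul_smul_comm, smul_smul]
  congr 1
  ring

theorem Datum.qad_sα' (D : Datum I) (i j : I) (x y : A) :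
    qad (D.sα' i j) x y (D.serreDeg i j)
      = qfact (D.vi i) (D.ti i) (D.serreDeg i j) • D.serreE i j x y := by
  rw [← D.qad_sα, qad_eq, qad_eq, D.qpoly_sα']

theorem Datum.serreE_map {B : Type*} [Ring B] [Algebra Qvt B] (D : Datum I) (i j : I)
    (g : A →ₐ[Qvt] B) (x y : A) : g (D.serreE i j x y) = D.serreE i j (g x) (g y) := by
  simp [Datum.serreE, Datum.divPow, map_sum]

theorem Datum.serreF_map {B : Type*} [Ring B] [Algebra Qvt B] (D : Datum I) (i j : I)
    (g : A →ₐ[Qvt] B) (x y : A) : g (D.serreF i j x y) = D.serreF i j (g x) (g y) := by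
  simp [Datum.serreF, Datum.divPow, map_sum]

theorem Datum.serreF_op (D : Datum I) (i j : I) (x y : A) :
    MulOpposite.op (D.serreF i j x y)
      = D.serreE i j (MulOpposite.op x) (MulOpposite.op y) := by
  simp only [Datum.serreF, Datum.serreE, Datum.divPow, Finset.op_sum, MulOpposite.op_smul,
    MulOpposite.op_mul, MulOpposite.op_pow, mul_assoc]

end Serre

/-- Generators of `U_{v,t}`. -/
inductive Gen (I : Type*)
  | E (i : I)
  | F (i : I)
  | K (i : I)
  | Kinv (i : I)
  | K' (i : I)
  | K'inv (i : I)

open Gen FreeAlgebra in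
/-- The defining relations of `U_{v,t}`. -/
inductive Rel (D : Datum I) : FreeAlgebra Qvt (Gen I) → FreeAlgebra Qvt (Gen I) → Prop
  | K_Kinv (i : I) : Rel D (ι Qvt (K i) * ι Qvt (Kinv i)) 1
  | Kinv_K (i : I) : Rel D (ι Qvt (Kinv i) * ι Qvt (K i)) 1
  | K'_K'inv (i : I) : Rel D (ι Qvt (K' i) * ι Qvt (K'inv i)) 1
  | K'inv_K' (i : I) : Rel D (ι Qvt (K'inv i) * ι Qvt (K' i)) 1
  | K_comm (i j : I) : Rel D (ι Qvt (K i) * ι Qvt (K j)) (ι Qvt (K j) * ι Qvt (K i))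
  | K_K'_comm (i j : I) : Rel D (ι Qvt (K i) * ι Qvt (K' j)) (ι Qvt (K' j) * ι Qvt (K i))
  | K'_comm (i j : I) : Rel D (ι Qvt (K' i) * ι Qvt (K' j)) (ι Qvt (K' j) * ι Qvt (K' i))
  | K_E (i j : I) : Rel D (ι Qvt (K i) * ι Qvt (E j) * ι Qvt (Kinv i))
      ((v ^ D.dot (sg i) (sg j) * t ^ (D.ang (sg j) (sg i) - D.ang (sg i) (sg j))) • ι Qvt (E j))
  | K'_E (i j : I) : Rel D (ι Qvt (K' i) * ι Qvt (E j) * ι Qvt (K'inv i))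
      ((v ^ (-D.dot (sg i) (sg j)) * t ^ (D.ang (sg j) (sg i) - D.ang (sg i) (sg j))) • ι Qvt (E j))
  | K'_F (i j : I) : Rel D (ι Qvt (K' i) * ι Qvt (F j) * ι Qvt (K'inv i))
      ((v ^ D.dot (sg i) (sg j) * t ^ (D.ang (sg i) (sg j) - D.ang (sg j) (sg i))) • ι Qvt (F j))
  | K_F (i j : I) : Rel D (ι Qvt (K i) * ι Qvt (F j) * ι Qvt (Kinv i))
      ((v ^ (-D.dot (sg i) (sg j)) * t ^ (D.ang (sg i) (sg j) - D.ang (sg j) (sg i))) • ι Qvt (F j))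
  | E_F (i j : I) : Rel D (ι Qvt (E i) * ι Qvt (F j) - ι Qvt (F j) * ι Qvt (E i))
      (if i = j then (D.vi i - (D.vi i)⁻¹)⁻¹ • (ι Qvt (K i) - ι Qvt (K' i)) else 0)
  | serre_E (i j : I) (h : i ≠ j) : Rel D (D.serreE i j (ι Qvt (E i)) (ι Qvt (E j))) 0
  | serre_F (i j : I) (h : i ≠ j) : Rel D (D.serreF i j (ι Qvt (F i)) (ι Qvt (F j))) 0

/-- The two-parameter quantum algebra `U_{v,t}`. -/
def U (D : Datum I) : Type _ := RingQuot (Rel D)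

instance (D : Datum I) : Ring (U D) := inferInstanceAs (Ring (RingQuot (Rel D)))

instance (D : Datum I) : Algebra Qvt (U D) := inferInstanceAs (Algebra Qvt (RingQuot (Rel D)))

/-- The quotient map from the free algebra. -/
def U.mk (D : Datum I) : FreeAlgebra Qvt (Gen I) →ₐ[Qvt] U D := RingQuot.mkAlgHom Qvt (Rel D)

theorem U.mk_rel (D : Datum I) {a b : FreeAlgebra Qvt (Gen I)} (h : Rel D a b) :
    U.mk D a = U.mk D b := RingQuot.mkAlgHom_rel Qvt h

/-- The universal property of `U_{v,t}`. -/
def U.lift (D : Datum I) {A : Type*} [Ring A] [Algebra Qvt A] (g : Gen I → A)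
    (hg : ∀ a b, Rel D a b → FreeAlgebra.lift Qvt g a = FreeAlgebra.lift Qvt g b) :
    U D →ₐ[Qvt] A := RingQuot.liftAlgHom Qvt ⟨FreeAlgebra.lift Qvt g, fun {a b} h => hg a b h⟩

/-- The image of a generator in `U_{v,t}`. -/
def U.gen (D : Datum I) (x : Gen I) : U D := U.mk D (FreeAlgebra.ι Qvt x)

theorem U.lift_gen (D : Datum I) {A : Type*} [Ring A] [Algebra Qvt A] (g : Gen I → A)
    (hg : ∀ a b, Rel D a b → FreeAlgebra.lift Qvt g a = FreeAlgebra.lift Qvt g b) (x : Gen I) :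
    U.lift D g hg (U.gen D x) = g x := by
  have := RingQuot.liftAlgHom_mkAlgHom_apply (S := Qvt) (s := Rel D) (FreeAlgebra.lift Qvt g)
    (fun {a b} h => hg a b h) (FreeAlgebra.ι Qvt x)
  exact this.trans (FreeAlgebra.lift_ι_apply _ _)

def U.E (D : Datum I) (i : I) : U D := U.gen D (.E i)
def U.F (D : Datum I) (i : I) : U D := U.gen D (.F i)
def U.K (D : Datum I) (i : I) : U D := U.gen D (.K i)
def U.Kinv (D : Datum I) (i : I) : U D := U.gen D (.Kinv i)
def U.K' (D : Datum I) (i : I) : U D := U.gen D (.K' i)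
def U.K'inv (D : Datum I) (i : I) : U D := U.gen D (.K'inv i)

section Comul

variable (D : Datum I)

/-- Values of the comultiplication on the generators. -/
def comulGen : Gen I → U D ⊗[Qvt] U D
  | .E i => U.E D i ⊗ₜ 1 + U.K D i ⊗ₜ U.E D i
  | .F i => 1 ⊗ₜ U.F D i + U.F D i ⊗ₜ U.K' D i
  | .K i => U.K D i ⊗ₜ U.K D i
  | .Kinv i => U.Kinv D i ⊗ₜ U.Kinv D i
  | .K' i => U.K' D i ⊗ₜ U.K' D i
  | .K'inv i => U.K'inv D i ⊗ₜ U.K'inv D i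

/-- Values of the counit on the generators. -/
def counitGen : Gen I → Qvt
  | .E _ => 0
  | .F _ => 0
  | _ => 1

theorem ang_sg (i j : I) : D.ang (sg i) (sg j) = D.Ω i j := by
  simp [Datum.ang, sg, Pi.single_apply]

theorem U.K_Kinv (i : I) : U.K D i * U.Kinv D i = 1 := by
  simpa [U.K, U.Kinv, U.gen] using U.mk_rel D (Rel.K_Kinv i)
theorem U.Kinv_K (i : I) : U.Kinv D i * U.K D i = 1 := by
  simpa [U.K, U.Kinv, U.gen] using U.mk_rel D (Rel.Kinv_K i)
theorem U.K'_K'inv (i : I) : U.K' D i * U.K'inv D i = 1 := by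
  simpa [U.K', U.K'inv, U.gen] using U.mk_rel D (Rel.K'_K'inv i)
theorem U.K'inv_K' (i : I) : U.K'inv D i * U.K' D i = 1 := by
  simpa [U.K', U.K'inv, U.gen] using U.mk_rel D (Rel.K'inv_K' i)
theorem U.K_comm (i j : I) : U.K D i * U.K D j = U.K D j * U.K D i := by
  simpa [U.K, U.gen] using U.mk_rel D (Rel.K_comm i j)
theorem U.K_K'_comm (i j : I) : U.K D i * U.K' D j = U.K' D j * U.K D i := by
  simpa [U.K, U.K', U.gen] using U.mk_rel D (Rel.K_K'_comm i j)
theorem U.K'_comm (i j : I) : U.K' D i * U.K' D j = U.K' D j * U.K' D i := by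
  simpa [U.K', U.gen] using U.mk_rel D (Rel.K'_comm i j)

theorem U.K_E (i j : I) : U.K D i * U.E D j =
    (v ^ (D.Ω i j + D.Ω j i) * t ^ (D.Ω j i - D.Ω i j)) • (U.E D j * U.K D i) := by
  have h := U.mk_rel D (Rel.K_E i j)
  simp only [map_mul, map_smul, Datum.dot, ang_sg] at h
  have h' := congrArg (· * U.K D i) h
  simp only [smul_mul_assoc] at h'
  rw [mul_assoc] at h'
  exact (by rw [show U.mk D (FreeAlgebra.ι Qvt (Gen.Kinv i)) = U.Kinv D i from rfl,
    U.Kinv_K, mul_one] at h'; exact h')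

theorem U.K'_E (i j : I) : U.K' D i * U.E D j =
    (v ^ (-(D.Ω i j + D.Ω j i)) * t ^ (D.Ω j i - D.Ω i j)) • (U.E D j * U.K' D i) := by
  have h := U.mk_rel D (Rel.K'_E i j)
  simp only [map_mul, map_smul, Datum.dot, ang_sg] at h
  have h' := congrArg (· * U.K' D i) h
  simp only [smul_mul_assoc] at h'
  rw [mul_assoc] at h'
  exact (by rw [show U.mk D (FreeAlgebra.ι Qvt (Gen.K'inv i)) = U.K'inv D i from rfl,
    U.K'inv_K', mul_one] at h'; exact h')

theorem U.K'_F (i j : I) : U.K' D i * U.F D j =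
    (v ^ (D.Ω i j + D.Ω j i) * t ^ (D.Ω i j - D.Ω j i)) • (U.F D j * U.K' D i) := by
  have h := U.mk_rel D (Rel.K'_F i j)
  simp only [map_mul, map_smul, Datum.dot, ang_sg] at h
  have h' := congrArg (· * U.K' D i) h
  simp only [smul_mul_assoc] at h'
  rw [mul_assoc] at h'
  exact (by rw [show U.mk D (FreeAlgebra.ι Qvt (Gen.K'inv i)) = U.K'inv D i from rfl,
    U.K'inv_K', mul_one] at h'; exact h')

theorem U.K_F (i j : I) : U.K D i * U.F D j =
    (v ^ (-(D.Ω i j + D.Ω j i)) * t ^ (D.Ω i j - D.Ω j i)) • (U.F D j * U.K D i) := by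
  have h := U.mk_rel D (Rel.K_F i j)
  simp only [map_mul, map_smul, Datum.dot, ang_sg] at h
  have h' := congrArg (· * U.K D i) h
  simp only [smul_mul_assoc] at h'
  rw [mul_assoc] at h'
  exact (by rw [show U.mk D (FreeAlgebra.ι Qvt (Gen.Kinv i)) = U.Kinv D i from rfl,
    U.Kinv_K, mul_one] at h'; exact h')

theorem U.E_F (i j : I) : U.E D i * U.F D j - U.F D j * U.E D i =
    if i = j then (D.vi i - (D.vi i)⁻¹)⁻¹ • (U.K D i - U.K' D i) else 0 := by
  have h := U.mk_rel D (Rel.E_F i j)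
  rw [apply_ite (U.mk D)] at h
  simpa [map_sub, map_mul, map_smul, U.E, U.F, U.K, U.K', U.gen] using h

theorem U.serre_E (i j : I) (h : i ≠ j) : D.serreE i j (U.E D i) (U.E D j) = 0 := by
  have := U.mk_rel D (Rel.serre_E i j h)
  rwa [Datum.serreE_map, map_zero] at this

theorem U.serre_F (i j : I) (h : i ≠ j) : D.serreF i j (U.F D i) (U.F D j) = 0 := by
  have := U.mk_rel D (Rel.serre_F i j h)
  rwa [Datum.serreF_map, map_zero] at this

theorem conj_smul {A : Type*} [Ring A] [Algebra Qvt A] {k l e : A} {c : Qvt}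
    (h : k * e = c • (e * k)) (h1 : k * l = 1) : k * e * l = c • e := by
  rw [h, smul_mul_assoc, mul_assoc, h1, mul_one]


section Abstract

variable {A : Type*} [Ring A] [Algebra Qvt A]

theorem qad_conj (α : ℕ → Qvt) {X Y K : A} {a b : Qvt} (hX : K * X = a • (X * K))
    (hY : K * Y = b • (Y * K)) (m : ℕ) :
    K * qad α X Y m = (a ^ m * b) • (qad α X Y m * K) := by
  induction m with
  | zero => simpa [qad] using hY
  | succ m ih =>
    simp only [qad, mul_sub, sub_mul, smul_sub, mul_smul_comm, smul_mul_assoc]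
    rw [← mul_assoc, ih, ← mul_assoc K X, hX]
    simp only [smul_mul_assoc, mul_assoc, hX, ih, mul_smul_comm, smul_smul]
    congr 2
    · ring
    · ring

theorem qad_left (α : ℕ → Qvt) {X Y K : A} {a b : Qvt} (hX : K * X = a • (X * K))
    (hY : K * Y = b • (Y * K)) (hα : ∀ m, α m * (a ^ m * b) = 1) (m : ℕ) :
    qad α (X ⊗ₜ[Qvt] (1 : A) + K ⊗ₜ[Qvt] X) (Y ⊗ₜ[Qvt] (1 : A)) m
      = qad α X Y m ⊗ₜ[Qvt] (1 : A) := by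
  induction m with
  | zero => rfl
  | succ m ih =>
    simp only [qad, ih, mul_add, add_mul, Algebra.TensorProduct.tmul_mul_tmul, one_mul, mul_one,
      qad_conj α hX hY m, smul_add, TensorProduct.sub_tmul, TensorProduct.smul_tmul', smul_smul, hα,
      one_smul]
    abel

theorem qad_right (α : ℕ → Qvt) {X Y K L : A} {a b : Qvt} (hX : K * X = a • (X * K))
    (hL : L * X = b • (X * L)) (hKL : K * L = L * K) (hα : ∀ m, α m = a ^ m * b) (m : ℕ) :
    qad α (X ⊗ₜ[Qvt] (1 : A) + K ⊗ₜ[Qvt] X) (L ⊗ₜ[Qvt] Y) m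
      = (K ^ m * L) ⊗ₜ[Qvt] qad α X Y m := by
  have hc : ∀ m, (K ^ m * L) * X = α m • (X * (K ^ m * L)) := by
    intro m
    induction m with
    | zero => simp [hα, hL]
    | succ m ih =>
      rw [pow_succ', mul_assoc, mul_assoc, ← mul_assoc (K ^ m), ih, mul_smul_comm, ← mul_assoc K X,
        hX, smul_mul_assoc, smul_smul, hα, hα]
      simp only [mul_assoc]
      congr 1; ring
  have hk : ∀ m, (K ^ m * L) * K = K ^ (m + 1) * L := by
    intro m
    rw [mul_assoc, ← hKL, ← mul_assoc, pow_succ]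
  induction m with
  | zero => simp [qad]
  | succ m ih =>
    simp only [qad, ih, mul_add, add_mul, Algebra.TensorProduct.tmul_mul_tmul, one_mul, mul_one,
      hc, hk, smul_add, TensorProduct.tmul_sub, TensorProduct.tmul_smul, TensorProduct.smul_tmul']
    rw [← mul_assoc K, ← pow_succ']
    abel

theorem serreE_comul (D : Datum I) (i j : I) (α β : ℕ → Qvt)
    (hα' : qpoly α (D.serreDeg i j) = qpoly (D.sα i j) (D.serreDeg i j))
    (hβ' : qpoly β (D.serreDeg i j) = qpoly (D.sα i j) (D.serreDeg i j))
    {X Y K L : A} {a b c : Qvt} (hX : K * X = a • (X * K))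
    (hY : K * Y = b • (Y * K)) (hL : L * X = c • (X * L)) (hKL : K * L = L * K)
    (hα : ∀ m, α m * (a ^ m * b) = 1) (hβ : ∀ m, β m = a ^ m * c)
    (h0 : D.serreE i j X Y = 0) :
    D.serreE i j (X ⊗ₜ[Qvt] (1 : A) + K ⊗ₜ[Qvt] X) (Y ⊗ₜ[Qvt] (1 : A) + L ⊗ₜ[Qvt] Y) = 0 := by
  have key : ∀ (γ : ℕ → Qvt), qpoly γ (D.serreDeg i j) = qpoly (D.sα i j) (D.serreDeg i j) →
      qad γ X Y (D.serreDeg i j) = 0 := by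
    intro γ hγ
    have := D.qad_sα i j X Y
    rw [h0, smul_zero, qad_eq, ← hγ, ← qad_eq] at this
    exact this
  have h := D.qad_sα i j (X ⊗ₜ[Qvt] (1 : A) + K ⊗ₜ[Qvt] X) (Y ⊗ₜ[Qvt] (1 : A) + L ⊗ₜ[Qvt] Y)
  rw [qad_add] at h
  have h1 : qad (D.sα i j) (X ⊗ₜ[Qvt] (1 : A) + K ⊗ₜ[Qvt] X) (Y ⊗ₜ[Qvt] (1 : A))
      (D.serreDeg i j) = 0 := by
    rw [qad_eq, ← hα', ← qad_eq, qad_left α hX hY hα, key α hα', TensorProduct.zero_tmul]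
  have h2 : qad (D.sα i j) (X ⊗ₜ[Qvt] (1 : A) + K ⊗ₜ[Qvt] X) (L ⊗ₜ[Qvt] Y)
      (D.serreDeg i j) = 0 := by
    rw [qad_eq, ← hβ', ← qad_eq, qad_right β hX hL hKL hβ, key β hβ', TensorProduct.tmul_zero]
  rw [h1, h2, add_zero] at h
  exact (smul_eq_zero.1 h.symm).resolve_left (D.qfact_ne_zero i _)

end Abstract

theorem comul_serreE (i j : I) (h : i ≠ j) :
    D.serreE i j (comulGen D (.E i)) (comulGen D (.E j)) = 0 := by
  have hd := D.serreDeg_eq i j h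
  refine serreE_comul D i j (D.sα' i j) (D.sα i j) (D.qpoly_sα' i j) rfl (U.K_E D i i)
    (U.K_E D i j) (U.K_E D j i) (U.K_comm D i j) ?_ ?_ (U.serre_E D i j h)
  · intro m
    have hv := v_ne_zero
    have ht := t_ne_zero
    rw [Datum.sα', hd, sub_self, zpow_zero, mul_one, ← zpow_natCast, ← zpow_mul,
      show ∀ x y z w u : Qvt, x * y * (z * (w * u)) = (x * u) * (y * z * w) by intros; ring,
      ← zpow_add₀ ht, ← zpow_add₀ hv, ← zpow_add₀ hv]
    rw [show D.Ω i j - D.Ω j i + (D.Ω j i - D.Ω i j) = 0 by ring, zpow_zero, one_mul]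
    convert zpow_zero v using 2
    ring
  · intro m
    have hv := v_ne_zero
    rw [Datum.sα, add_comm (D.Ω j i), hd, sub_self, zpow_zero, mul_one, ← zpow_natCast, ← zpow_mul,
      ← mul_assoc, ← zpow_add₀ hv, mul_comm]
    congr 2
    ring

theorem op_comm_smul {A : Type*} [Ring A] [Algebra Qvt A] {x k : A} {c : Qvt} (hc : c ≠ 0)
    (h : k * x = c • (x * k)) :
    MulOpposite.op k * MulOpposite.op x = c⁻¹ • (MulOpposite.op x * MulOpposite.op k) := by
  rw [← MulOpposite.op_mul, ← MulOpposite.op_mul, h, MulOpposite.op_smul, smul_smul,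
    inv_mul_cancel₀ hc, one_smul]

theorem vt_ne_zero (a b : ℤ) : v ^ a * t ^ b ≠ 0 :=
  mul_ne_zero (zpow_ne_zero _ v_ne_zero) (zpow_ne_zero _ t_ne_zero)

theorem comul_serreF (i j : I) (h : i ≠ j) :
    D.serreF i j (comulGen D (.F i)) (comulGen D (.F j)) = 0 := by
  have hd := D.serreDeg_eq i j h
  have hv := v_ne_zero
  have ht := t_ne_zero
  have key := serreE_comul D i j (D.sα i j) (D.sα' i j) rfl (D.qpoly_sα' i j)
    (op_comm_smul (vt_ne_zero _ _) (U.K'_F D i i))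
    (op_comm_smul (vt_ne_zero _ _) (U.K'_F D i j)) (op_comm_smul (vt_ne_zero _ _) (U.K'_F D j i))
    (by rw [← MulOpposite.op_mul, ← MulOpposite.op_mul, U.K'_comm D i j]) ?_ ?_
    (by rw [← Datum.serreF_op, U.serre_F D i j h, MulOpposite.op_zero])
  · have k2 := congrArg ((Algebra.TensorProduct.opAlgEquiv Qvt Qvt (U D) (U D)).toAlgHom.comp
      (Algebra.TensorProduct.comm Qvt (U D)ᵐᵒᵖ (U D)ᵐᵒᵖ).toAlgHom) key
    rw [Datum.serreE_map, map_zero] at k2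
    apply MulOpposite.op_injective
    rw [Datum.serreF_op, MulOpposite.op_zero, ← k2]
    congr 1
  · intro m
    rw [Datum.sα, hd, sub_self, zpow_zero, mul_one, inv_pow, ← mul_inv, ← zpow_natCast, ← zpow_mul,
      mul_inv_eq_one₀ (mul_ne_zero (zpow_ne_zero _ hv) (vt_ne_zero _ _)), ← mul_assoc,
      ← zpow_add₀ hv, mul_comm]
    congr 2
    ring
  · intro m
    rw [Datum.sα', add_comm (D.Ω j i), hd, sub_self, zpow_zero, mul_one, inv_pow, ← mul_inv,
      ← zpow_natCast, ← zpow_mul, ← mul_assoc, ← zpow_add₀ hv, mul_inv, ← zpow_neg, ← zpow_neg,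
      mul_comm]
    congr 2 <;> ring

theorem conj_one {A : Type*} [Ring A] {k l e : A} (h : k * e = e * k) (h1 : k * l = 1) :
    k * e * l = e := by
  rw [h, mul_assoc, h1, mul_one]

theorem comul_rel (a b : FreeAlgebra Qvt (Gen I)) (h : Rel D a b) :
    FreeAlgebra.lift Qvt (comulGen D) a = FreeAlgebra.lift Qvt (comulGen D) b := by
  cases h with
  | K_Kinv i => simp [comulGen, U.K_Kinv, Algebra.TensorProduct.one_def]
  | Kinv_K i => simp [comulGen, U.Kinv_K, Algebra.TensorProduct.one_def]
  | K'_K'inv i => simp [comulGen, U.K'_K'inv, Algebra.TensorProduct.one_def]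
  | K'inv_K' i => simp [comulGen, U.K'inv_K', Algebra.TensorProduct.one_def]
  | K_comm i j => simp [comulGen, U.K_comm D i j]
  | K_K'_comm i j => simp [comulGen, U.K_K'_comm D i j]
  | K'_comm i j => simp [comulGen, U.K'_comm D i j]
  | K_E i j =>
    simp only [map_mul, map_smul, FreeAlgebra.lift_ι_apply, comulGen, mul_add, add_mul, smul_add,
      Algebra.TensorProduct.tmul_mul_tmul, mul_one, U.K_Kinv, Datum.dot, ang_sg,
      conj_smul (U.K_E D i j) (U.K_Kinv D i), conj_one (U.K_comm D i j) (U.K_Kinv D i),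
      TensorProduct.tmul_smul, TensorProduct.smul_tmul']
  | K'_E i j =>
    simp only [map_mul, map_smul, FreeAlgebra.lift_ι_apply, comulGen, mul_add, add_mul, smul_add,
      Algebra.TensorProduct.tmul_mul_tmul, mul_one, U.K'_K'inv, Datum.dot, ang_sg,
      conj_smul (U.K'_E D i j) (U.K'_K'inv D i),
      conj_one (U.K_K'_comm D j i).symm (U.K'_K'inv D i),
      TensorProduct.tmul_smul, TensorProduct.smul_tmul']
  | K'_F i j =>
    simp only [map_mul, map_smul, FreeAlgebra.lift_ι_apply, comulGen, mul_add, add_mul, smul_add,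
      Algebra.TensorProduct.tmul_mul_tmul, mul_one, U.K'_K'inv, Datum.dot, ang_sg,
      conj_smul (U.K'_F D i j) (U.K'_K'inv D i),
      conj_one (U.K'_comm D i j) (U.K'_K'inv D i),
      TensorProduct.tmul_smul, TensorProduct.smul_tmul']
  | K_F i j =>
    simp only [map_mul, map_smul, FreeAlgebra.lift_ι_apply, comulGen, mul_add, add_mul, smul_add,
      Algebra.TensorProduct.tmul_mul_tmul, mul_one, U.K_Kinv, Datum.dot, ang_sg,
      conj_smul (U.K_F D i j) (U.K_Kinv D i), conj_one (U.K_K'_comm D i j) (U.K_Kinv D i),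
      TensorProduct.tmul_smul, TensorProduct.smul_tmul']
  | E_F i j =>
    have hx : (U.K D i * U.F D j) ⊗ₜ[Qvt] (U.E D i * U.K' D j)
        = (U.F D j * U.K D i) ⊗ₜ[Qvt] (U.K' D j * U.E D i) := by
      rw [U.K_F, U.K'_E, TensorProduct.smul_tmul, add_comm (D.Ω j i)]
    have hl : FreeAlgebra.lift Qvt (comulGen D) (FreeAlgebra.ι Qvt (Gen.E i) *
          FreeAlgebra.ι Qvt (Gen.F j) - FreeAlgebra.ι Qvt (Gen.F j) * FreeAlgebra.ι Qvt (Gen.E i))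
        = (U.E D i * U.F D j - U.F D j * U.E D i) ⊗ₜ U.K' D j
          + U.K D i ⊗ₜ (U.E D i * U.F D j - U.F D j * U.E D i) := by
      simp only [map_mul, map_sub, FreeAlgebra.lift_ι_apply, comulGen, mul_add, add_mul,
        Algebra.TensorProduct.tmul_mul_tmul, mul_one, one_mul, hx, TensorProduct.sub_tmul,
        TensorProduct.tmul_sub]
      abel
    rw [hl, U.E_F]
    split_ifs with hij
    · subst hij
      simp only [map_smul, map_sub, FreeAlgebra.lift_ι_apply, comulGen, TensorProduct.tmul_smul,
        ← TensorProduct.smul_tmul', TensorProduct.sub_tmul, TensorProduct.tmul_sub, ← smul_add]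
      congr 1
      abel
    · simp
  | serre_E i j h =>
    rw [Datum.serreE_map, map_zero]
    simpa using comul_serreE D i j h
  | serre_F i j h =>
    rw [Datum.serreF_map, map_zero]
    simpa using comul_serreF D i j h

/-- The comultiplication `Δ : U → U ⊗ U`. -/
def comul : U D →ₐ[Qvt] U D ⊗[Qvt] U D := U.lift D (comulGen D) (comul_rel D)

theorem counit_rel (a b : FreeAlgebra Qvt (Gen I)) (h : Rel D a b) :
    FreeAlgebra.lift Qvt counitGen a = FreeAlgebra.lift Qvt counitGen b := by
  cases h with
  | E_F i j => split_ifs <;> simp [counitGen]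
  | serre_E i j h => simp [counitGen, Datum.serreE]
  | serre_F i j h => simp [counitGen, Datum.serreF]
  | _ => simp [counitGen]

/-- The counit `ε : U → ℚ(v,t)`. -/
def counit : U D →ₐ[Qvt] Qvt := U.lift D counitGen (counit_rel D)

end Comul

section Pairing

variable (D : Datum I)

/-- `K_i` as a unit. -/
def Kunit (i : I) : (U D)ˣ := ⟨U.K D i, U.Kinv D i, U.K_Kinv D i, U.Kinv_K D i⟩

/-- `K'_i` as a unit. -/
def K'unit (i : I) : (U D)ˣ := ⟨U.K' D i, U.K'inv D i, U.K'_K'inv D i, U.K'inv_K' D i⟩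

theorem Kunit_comm (m : I → ℤ) (s : Set I) :
    s.Pairwise (Function.onFun Commute fun i => ((Kunit D i ^ m i : (U D)ˣ) : U D)) := by
  intro i _ j _ _
  have h : Commute (Kunit D i) (Kunit D j) := Units.ext (U.K_comm D i j)
  exact congrArg Units.val ((h.zpow_zpow (m i) (m j)).eq)

theorem K'unit_comm (m : I → ℤ) (s : Set I) :
    s.Pairwise (Function.onFun Commute fun i => ((K'unit D i ^ m i : (U D)ˣ) : U D)) := by
  intro i _ j _ _
  have h : Commute (K'unit D i) (K'unit D j) := Units.ext (U.K'_comm D i j)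
  exact congrArg Units.val ((h.zpow_zpow (m i) (m j)).eq)

/-- `K_μ = ∏ K_i^{μ_i}` for `μ ∈ ℤ[I]`. -/
def Kw (m : I → ℤ) : U D :=
  Finset.univ.noncommProd (fun i => ((Kunit D i ^ m i : (U D)ˣ) : U D)) (Kunit_comm D m _)

/-- `K'_μ = ∏ K'_i^{μ_i}` for `μ ∈ ℤ[I]`. -/
def K'w (m : I → ℤ) : U D :=
  Finset.univ.noncommProd (fun i => ((K'unit D i ^ m i : (U D)ˣ) : U D)) (K'unit_comm D m _)

/-- The subalgebra `U_{≥0}`, generated by the `E_i` and `K_i^{±1}`. -/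
def Ugeq : Subalgebra Qvt (U D) :=
  Algebra.adjoin Qvt (Set.range (U.E D) ∪ Set.range (U.K D) ∪ Set.range (U.Kinv D))

/-- The subalgebra `U_{≤0}`, generated by the `F_i` and `K'_i^{±1}`. -/
def Uleq : Subalgebra Qvt (U D) :=
  Algebra.adjoin Qvt (Set.range (U.F D) ∪ Set.range (U.K' D) ∪ Set.range (U.K'inv D))

/-- The degree in `ℕ[I]` of the word `i_1 ⋯ i_l`. -/
def wordDeg (w : List I) : I → ℕ := fun i => w.count i

/-- `U^+_ν`: the span of the monomials `E_{i_1} ⋯ E_{i_l}` of degree `ν`. -/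
def Uplus (n : I → ℕ) : Submodule Qvt (U D) :=
  Submodule.span Qvt {x | ∃ w : List I, wordDeg w = n ∧ x = (w.map (U.E D)).prod}

/-- `U^-_{-ν}`: the span of the monomials `F_{i_1} ⋯ F_{i_l}` of degree `ν`. -/
def Uminus (n : I → ℕ) : Submodule Qvt (U D) :=
  Submodule.span Qvt {x | ∃ w : List I, wordDeg w = n ∧ x = (w.map (U.F D)).prod}

theorem E_mem (i : I) : U.E D i ∈ Ugeq D :=
  Algebra.subset_adjoin (Or.inl (Or.inl ⟨i, rfl⟩))

theorem F_mem (i : I) : U.F D i ∈ Uleq D :=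
  Algebra.subset_adjoin (Or.inl (Or.inl ⟨i, rfl⟩))

theorem Kw_mem (m : I → ℤ) : Kw D m ∈ Ugeq D := by
  refine Submonoid.noncommProd_mem (Ugeq D).toSubmonoid _ _ _ fun i _ => ?_
  cases m i with
  | ofNat n =>
    simpa [Kunit] using pow_mem (show U.K D i ∈ Ugeq D from
      Algebra.subset_adjoin (Or.inl (Or.inr ⟨i, rfl⟩))) n
  | negSucc n =>
    rw [zpow_negSucc, ← inv_pow, Units.val_pow_eq_pow_val]
    exact pow_mem (show U.Kinv D i ∈ Ugeq D from
      Algebra.subset_adjoin (Or.inr ⟨i, rfl⟩)) (n + 1)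

theorem K'w_mem (m : I → ℤ) : K'w D m ∈ Uleq D := by
  refine Submonoid.noncommProd_mem (Uleq D).toSubmonoid _ _ _ fun i _ => ?_
  cases m i with
  | ofNat n =>
    simpa [K'unit] using pow_mem (show U.K' D i ∈ Uleq D from
      Algebra.subset_adjoin (Or.inl (Or.inr ⟨i, rfl⟩))) n
  | negSucc n =>
    rw [zpow_negSucc, ← inv_pow, Units.val_pow_eq_pow_val]
    exact pow_mem (show U.K'inv D i ∈ Uleq D from
      Algebra.subset_adjoin (Or.inr ⟨i, rfl⟩)) (n + 1)

theorem Uplus_le (n : I → ℕ) : Uplus D n ≤ Subalgebra.toSubmodule (Ugeq D) := by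
  refine Submodule.span_le.2 ?_
  rintro _ ⟨w, -, rfl⟩
  exact Subalgebra.list_prod_mem _ fun x hx => by
    obtain ⟨i, -, rfl⟩ := List.mem_map.1 hx
    exact E_mem D i

theorem Uminus_le (n : I → ℕ) : Uminus D n ≤ Subalgebra.toSubmodule (Uleq D) := by
  refine Submodule.span_le.2 ?_
  rintro _ ⟨w, -, rfl⟩
  exact Subalgebra.list_prod_mem _ fun x hx => by
    obtain ⟨i, -, rfl⟩ := List.mem_map.1 hx
    exact F_mem D i

/-- `K_μ` as an element of `U_{≥0}`. -/
def Kgeq (m : I → ℤ) : Ugeq D := ⟨Kw D m, Kw_mem D m⟩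

/-- `K'_μ` as an element of `U_{≤0}`. -/
def K'leq (m : I → ℤ) : Uleq D := ⟨K'w D m, K'w_mem D m⟩

/-- The inclusion `ℕ[I] ⊂ ℤ[I]`. -/
def toZ (n : I → ℕ) : I → ℤ := fun i => n i

/-- `φ` is a skew-Hopf pairing `U_{≥0} × U_{≤0} → ℚ(v,t)` with the prescribed values:
`(x, y y') = (Δ(x), y ⊗ y')` and `(x x', y) = (x ⊗ x', Δ^{op}(y))`, where `z` denotes `Δ(x)`
(resp. `Δ(y)`) seen in `U_{≥0} ⊗ U_{≥0}` (resp. `U_{≤0} ⊗ U_{≤0}`). Compatibility with the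
antipodes is a formal consequence of these axioms. -/
structure IsSkewHopfPairing (φ : Ugeq D →ₗ[Qvt] Uleq D →ₗ[Qvt] Qvt) : Prop where
  one_left : ∀ y : Uleq D, φ 1 y = counit D y
  one_right : ∀ x : Ugeq D, φ x 1 = counit D x
  mul_right : ∀ (x : Ugeq D) (y y' : Uleq D) (z : Ugeq D ⊗[Qvt] Ugeq D),
    TensorProduct.map (Ugeq D).val.toLinearMap (Ugeq D).val.toLinearMap z = comul D x →
    φ x (y * y') = LinearMap.mul' Qvt Qvt (TensorProduct.map (φ.flip y) (φ.flip y') z)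
  mul_left : ∀ (x x' : Ugeq D) (y : Uleq D) (z : Uleq D ⊗[Qvt] Uleq D),
    TensorProduct.map (Uleq D).val.toLinearMap (Uleq D).val.toLinearMap z = comul D y →
    φ (x * x') y = LinearMap.mul' Qvt Qvt
      (TensorProduct.map (φ x) (φ x') (TensorProduct.comm Qvt (Uleq D) (Uleq D) z))
  E_F : ∀ i j : I, φ ⟨U.E D i, E_mem D i⟩ ⟨U.F D j, F_mem D j⟩
    = if i = j then ((D.vi i)⁻¹ - D.vi i)⁻¹ else 0
  K_K' : ∀ (m n : I → ℤ) (a b : I → ℕ) (x : Ugeq D) (y : Uleq D),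
    (x : U D) ∈ Uplus D a → (y : U D) ∈ Uminus D b →
    φ (Kgeq D m * x) (K'leq D n * y)
      = D.brace m n * D.brace m (toZ b) * D.brace (toZ a) n * φ x y

open Classical in
/-- The skew-Hopf pairing `(,)_φ` (it exists and is unique). -/
def pairing : Ugeq D →ₗ[Qvt] Uleq D →ₗ[Qvt] Qvt :=
  if h : ∃ φ, IsSkewHopfPairing D φ then h.choose else 0

/-- `f(λ, μ) = (K_λ, K'_μ)_φ^{-1}`. -/
def fmap (l m : I → ℤ) : Qvt := (pairing D (Kgeq D l) (K'leq D m))⁻¹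

open Classical in
/-- A homogeneous basis `B = ⨆ B_ν` of `U^-`, with `B_ν` a basis of `U^-_{-ν}`, together with the
basis `{b^*}` of `U^+_ν` dual to `B_ν` under `(,)_φ`. -/
structure DualBases where
  ix : (I → ℕ) → Type
  fin : ∀ n, Fintype (ix n)
  b : ∀ n, Module.Basis (ix n) Qvt (Uminus D n)
  bs : ∀ n, Module.Basis (ix n) Qvt (Uplus D n)
  dual : ∀ n k l, pairing D ⟨bs n k, Uplus_le D n (bs n k).2⟩ ⟨b n l, Uminus_le D n (b n l).2⟩
    = if k = l then 1 else 0

/-- `Θ_ν = ∑_{b ∈ B_ν} b ⊗ b^*`. -/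
def DualBases.theta {D : Datum I} (B : DualBases D) (n : I → ℕ) : U D ⊗[Qvt] U D :=
  letI := B.fin n
  ∑ k, (B.b n k : U D) ⊗ₜ[Qvt] (B.bs n k : U D)

end Pairing

section Modules

variable (D : Datum I) (M N : Type*) [AddCommGroup M] [Module Qvt M] [Module (U D) M]
  [IsScalarTower Qvt (U D) M] [AddCommGroup N] [Module Qvt N] [Module (U D) N]
  [IsScalarTower Qvt (U D) N]

/-- `c_{i,λ} = t^{⟨λ,i⟩-⟨i,λ⟩}`. -/
def Datum.c (i : I) (l : I → ℤ) : Qvt := t ^ (D.ang l (sg i) - D.ang (sg i) l)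

/-- The weight space `M_λ`, `λ ∈ ℤ[I]`. -/
def weightSpace (l : I → ℤ) : Submodule Qvt M where
  carrier := {x | ∀ i, U.K D i • x = (v ^ D.dot (sg i) l * D.c i l) • x ∧
    U.K' D i • x = (v ^ (-D.dot (sg i) l) * D.c i l) • x}
  add_mem' hx hy i := ⟨by rw [smul_add, smul_add, (hx i).1, (hy i).1],
    by rw [smul_add, smul_add, (hx i).2, (hy i).2]⟩
  zero_mem' i := by simp
  smul_mem' a x hx i := ⟨by rw [← algebraMap_smul (U D) a x, ← mul_smul, ← Algebra.commutes, mul_smul,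
      (hx i).1, algebraMap_smul, algebraMap_smul, smul_comm],
    by rw [← algebraMap_smul (U D) a x, ← mul_smul, ← Algebra.commutes, mul_smul,
      (hx i).2, algebraMap_smul, algebraMap_smul, smul_comm]⟩

/-- `M` is a weight module: `M = ⨁_λ M_λ`. -/
def IsWeightModule : Prop := DirectSum.IsInternal (weightSpace D M)

/-- The action of `U ⊗ U` on `M ⊗ N`. -/
def tensorEnd : U D ⊗[Qvt] U D →ₐ[Qvt] Module.End Qvt (M ⊗[Qvt] N) :=
  (Module.endTensorEndAlgHom (R := Qvt) (S := Qvt) (A := Qvt) (M := M) (N := N)).comp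
    (Algebra.TensorProduct.map (Algebra.lsmul Qvt Qvt M) (Algebra.lsmul Qvt Qvt N))

/-- The `U`-module structure of `M ⊗ N`, through the comultiplication. -/
def tensorAct : U D →ₐ[Qvt] Module.End Qvt (M ⊗[Qvt] N) := (tensorEnd D M N).comp (comul D)

variable {D M N}

/-- The weight decomposition of a weight module. -/
def IsWeightModule.decomp (h : IsWeightModule D M) :
    M ≃ₗ[Qvt] DirectSum (I → ℤ) fun l => weightSpace D M l :=
  (LinearEquiv.ofBijective (DirectSum.coeLinearMap (weightSpace D M)) h).symm

/-- The bilinear map `(m, n) ↦ f(λ, μ) m ⊗ n` for `m ∈ M_λ`, `n ∈ N_μ`. -/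
def ftildeAux (hM : IsWeightModule D M) (hN : IsWeightModule D N) :
    M →ₗ[Qvt] N →ₗ[Qvt] M ⊗[Qvt] N :=
  (DirectSum.toModule Qvt (I → ℤ) (N →ₗ[Qvt] M ⊗[Qvt] N) fun l =>
    ((DirectSum.toModule Qvt (I → ℤ) (weightSpace D M l →ₗ[Qvt] M ⊗[Qvt] N) fun m =>
      fmap D l m • ((TensorProduct.mk Qvt M N).compl₁₂ (weightSpace D M l).subtype
        (weightSpace D N m).subtype).flip).comp hN.decomp.toLinearMap).flip).comp
    hM.decomp.toLinearMap

/-- `f̃ : M ⊗ N → M ⊗ N`. -/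
def ftilde (hM : IsWeightModule D M) (hN : IsWeightModule D N) :
    M ⊗[Qvt] N →ₗ[Qvt] M ⊗[Qvt] N := TensorProduct.lift (ftildeAux hM hN)

variable (M N)

/-- The operator `Θ = ∑_ν Θ_ν` on `M ⊗ N`. -/
def DualBases.thetaOp (B : DualBases D) : Module.End Qvt (M ⊗[Qvt] N) :=
  ∑ᶠ n : I → ℕ, tensorEnd D M N (B.theta n)

variable {M N}

/-- `𝓡 = Θ ∘ f̃ ∘ P : M ⊗ N → N ⊗ M`. -/
def DualBases.Rmat (B : DualBases D) (hM : IsWeightModule D M)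
    (hN : IsWeightModule D N) : M ⊗[Qvt] N →ₗ[Qvt] N ⊗[Qvt] M :=
  B.thetaOp N M ∘ₗ ftilde hN hM ∘ₗ (TensorProduct.comm Qvt M N).toLinearMap

end Modules

end TwoParam

end

/-!
A left or right multiplication by `E_i` or `F_i` is adjoint, under the skew-Hopf pairing, to the
contraction of one leg of the comultiplication with `F_i` or `E_i`. These contractions are skew
derivations, and `[E_i, y]` for `y ∈ U⁻` is the difference of two of them, because both sides obey
the same Leibniz rule in `y` and agree on the letters `F_j`. Since `Θ_ν` is the canonical element of
the pairing in degree `ν`, an operator on its left leg may be traded for the adjoint operator on its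
right leg, which turns the commutator formula into the relation between `Θ_ν` and `Θ_{ν-i}`
```
Θ_ν (E_i ⊗ 1) + Θ_{ν-i} (K'_i ⊗ E_i) = (E_i ⊗ 1) Θ_ν + (K_i ⊗ E_i) Θ_{ν-i},
```
and likewise for `F_i`. Summed over `ν` it says that `Θ` intertwines `Δ(E_i)` with the operator
`E_i ⊗ 1 + K'_i ⊗ E_i`, and conjugation by `f̃` takes the opposite comultiplication of `E_i` to
exactly that operator.

For `ν ≠ 0`, `Θ_ν` lowers the weights of the left tensor factor. So only finitely many `Θ_ν` act
non-trivially as soon as this factor has finitely many weights, and `Θ - 1` is nilpotent.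
-/

noncomputable section

namespace TwoParam

section Form

variable {I : Type*} [Fintype I] (D : Datum I)

theorem Datum.ang_add_left (a b c : I → ℤ) : D.ang (a + b) c = D.ang a c + D.ang b c := by
  simp only [Datum.ang, Pi.add_apply, add_mul, Finset.sum_add_distrib]

theorem Datum.ang_add_right (a b c : I → ℤ) : D.ang a (b + c) = D.ang a b + D.ang a c := by
  simp only [Datum.ang, Pi.add_apply, mul_add, add_mul, Finset.sum_add_distrib]

theorem Datum.brace_ne_zero (a b : I → ℤ) : D.brace a b ≠ 0 := vt_ne_zero _ _

theorem Datum.brace_add_left (a b c : I → ℤ) :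
    D.brace (a + b) c = D.brace a c * D.brace b c := by
  simp only [Datum.brace, Datum.dot, D.ang_add_left, D.ang_add_right]
  rw [mul_mul_mul_comm, ← zpow_add₀ v_ne_zero, ← zpow_add₀ t_ne_zero]
  congr 2 <;> ring

theorem Datum.brace_add_right (a b c : I → ℤ) :
    D.brace a (b + c) = D.brace a b * D.brace a c := by
  simp only [Datum.brace, Datum.dot, D.ang_add_left, D.ang_add_right]
  rw [mul_mul_mul_comm, ← zpow_add₀ v_ne_zero, ← zpow_add₀ t_ne_zero]
  congr 2 <;> ring

theorem Datum.brace_zero_left (a : I → ℤ) : D.brace 0 a = 1 :=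
  mul_left_cancel₀ (D.brace_ne_zero 0 a) (by rw [← D.brace_add_left, add_zero, mul_one])

theorem Datum.brace_zero_right (a : I → ℤ) : D.brace a 0 = 1 :=
  mul_left_cancel₀ (D.brace_ne_zero a 0) (by rw [← D.brace_add_right, add_zero, mul_one])

theorem Datum.inv_brace (a b : I → ℤ) :
    (D.brace a b)⁻¹ = v ^ (-D.dot a b) * t ^ (D.ang a b - D.ang b a) := by
  rw [Datum.brace, mul_inv, ← zpow_neg, ← zpow_neg, neg_sub]

variable [DecidableEq I]

/-- The value `(E_i, F_i)_φ = (v_i⁻¹ - v_i)⁻¹` of the skew-Hopf pairing. -/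
def Datum.pairEF (i : I) : Qvt := ((D.vi i)⁻¹ - D.vi i)⁻¹

theorem U.K_E_brace (i j : I) :
    U.K D i * U.E D j = D.brace (sg i) (sg j) • (U.E D j * U.K D i) := by
  rw [U.K_E, Datum.brace, Datum.dot, ang_sg, ang_sg]

theorem U.K'_F_brace (i j : I) :
    U.K' D i * U.F D j = D.brace (sg j) (sg i) • (U.F D j * U.K' D i) := by
  rw [U.K'_F, Datum.brace, Datum.dot, ang_sg, ang_sg, add_comm]

theorem U.K_F_brace (i j : I) :
    U.K D i * U.F D j = (D.brace (sg i) (sg j))⁻¹ • (U.F D j * U.K D i) := by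
  rw [U.K_F, Datum.inv_brace, Datum.dot, ang_sg, ang_sg]

theorem U.K'_E_brace (i j : I) :
    U.K' D i * U.E D j = (D.brace (sg j) (sg i))⁻¹ • (U.E D j * U.K' D i) := by
  rw [U.K'_E, Datum.inv_brace, Datum.dot, ang_sg, ang_sg, add_comm]

theorem U.E_F_pairEF (i j : I) : U.E D i * U.F D j - U.F D j * U.E D i =
    (if i = j then D.pairEF i else 0) • (U.K' D i - U.K D i) := by
  rw [U.E_F, ite_smul, zero_smul, Datum.pairEF, ← neg_sub (D.vi i), inv_neg, neg_smul, ← smul_neg,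
    neg_sub]

theorem U.F_E_pairEF (i j : I) : U.F D i * U.E D j - U.E D j * U.F D i =
    (if i = j then D.pairEF i else 0) • (U.K D i - U.K' D i) := by
  rw [← neg_sub, U.E_F_pairEF]
  rcases eq_or_ne i j with rfl | hij
  · rw [← smul_neg, neg_sub]
  · rw [if_neg hij, if_neg hij.symm, zero_smul, zero_smul, neg_zero]

end Form

section Words

variable {R I A : Type*} [CommSemiring R] [DecidableEq I] [Semiring A] [Algebra R A]

theorem toZ_wordDeg_nil : toZ (wordDeg ([] : List I)) = 0 := by
  funext k; simp [toZ, wordDeg]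

theorem toZ_wordDeg_cons (j : I) (w : List I) :
    toZ (wordDeg (j :: w)) = sg j + toZ (wordDeg w) := by
  funext k
  rcases eq_or_ne k j with rfl | h
  · simp [toZ, wordDeg, sg, add_comm]
  · simp [toZ, wordDeg, sg, h, h.symm]

variable (R) in
/-- The span of the monomials `g i₁ ⋯ g iₗ` of degree `d`. The degree is taken in `ℤ[I]`, so that
`d - sg i` is the honest difference; the span is zero unless `d ∈ ℕ[I]`. -/
def wordSpan (g : I → A) (d : I → ℤ) : Submodule R A :=
  Submodule.span R {x | ∃ w : List I, toZ (wordDeg w) = d ∧ x = (w.map g).prod}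

variable {g : I → A} {d : I → ℤ} {x : A}

theorem one_mem_wordSpan : 1 ∈ wordSpan R g 0 :=
  Submodule.subset_span ⟨[], toZ_wordDeg_nil, rfl⟩

theorem letter_mul_mem_wordSpan (j : I) (hx : x ∈ wordSpan R g d) :
    g j * x ∈ wordSpan R g (sg j + d) := by
  suffices wordSpan R g d ≤ (wordSpan R g (sg j + d)).comap (LinearMap.mulLeft R (g j)) from this hx
  refine Submodule.span_le.2 ?_
  rintro _ ⟨w, rfl, rfl⟩
  exact Submodule.subset_span ⟨j :: w, toZ_wordDeg_cons j w, by simp⟩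

@[elab_as_elim]
theorem wordSpan_induction {p : ∀ (d : I → ℤ) (x : A), x ∈ wordSpan R g d → Prop}
    (one : p 0 1 one_mem_wordSpan)
    (letter_mul : ∀ j d x hx, p d x hx → p (sg j + d) (g j * x) (letter_mul_mem_wordSpan j hx))
    (zero : ∀ d, p d 0 (zero_mem _))
    (add : ∀ d x y hx hy, p d x hx → p d y hy → p d (x + y) (add_mem hx hy))
    (smul : ∀ d (a : R) x hx, p d x hx → p d (a • x) (Submodule.smul_mem _ a hx))
    (hx : x ∈ wordSpan R g d) : p d x hx := by
  induction hx using Submodule.span_induction with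
  | mem x hx =>
    obtain ⟨w, rfl, rfl⟩ := hx
    induction w with
    | nil =>
      simp only [toZ_wordDeg_nil, List.map_nil, List.prod_nil]
      exact one
    | cons j w ih =>
      simp only [toZ_wordDeg_cons, List.map_cons, List.prod_cons]
      exact letter_mul j _ _ _ ih
  | zero => exact zero d
  | add x y _ _ hx hy => exact add d x y _ _ hx hy
  | smul a x _ hx => exact smul d a x _ hx

theorem letter_mem_wordSpan (j : I) : g j ∈ wordSpan R g (sg j) := by
  simpa using letter_mul_mem_wordSpan j (one_mem_wordSpan (R := R) (g := g))

theorem mul_letter_mem_wordSpan (j : I) (hx : x ∈ wordSpan R g d) :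
    x * g j ∈ wordSpan R g (sg j + d) := by
  induction hx using wordSpan_induction with
  | one => simpa using letter_mem_wordSpan j
  | letter_mul k d x _ ih =>
    rw [mul_assoc, add_left_comm]
    exact letter_mul_mem_wordSpan k ih
  | zero => simp
  | add d x y _ _ hx hy => rw [add_mul]; exact add_mem hx hy
  | smul d a x _ hx => rw [smul_mul_assoc]; exact Submodule.smul_mem _ a hx

theorem wordSpan_eq_bot (hd : ∀ n : I → ℕ, toZ n ≠ d) : wordSpan R g d = ⊥ :=
  Submodule.span_eq_bot.2 fun _ ⟨_, h, _⟩ => (hd _ h).elim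

theorem exists_eq_algebraMap_of_mem_wordSpan_zero (hx : x ∈ wordSpan R g 0) :
    ∃ a : R, x = algebraMap R A a := by
  suffices wordSpan R g 0 ≤ LinearMap.range (Algebra.linearMap R A) by
    obtain ⟨a, rfl⟩ := this hx
    exact ⟨a, rfl⟩
  refine Submodule.span_le.2 ?_
  rintro _ ⟨w, hw, rfl⟩
  cases w with
  | nil => exact ⟨1, by simp⟩
  | cons j w =>
    have := congrFun hw j
    simp [toZ, wordDeg] at this
    omega

theorem map_wordSpan {B : Type*} [Semiring B] [Algebra R B] (f : A →ₐ[R] B) (g : I → A)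
    (d : I → ℤ) : (wordSpan R g d).map f.toLinearMap = wordSpan R (fun i => f (g i)) d := by
  rw [wordSpan, wordSpan, Submodule.map_span]
  congr 1
  ext x
  constructor
  · rintro ⟨_, ⟨w, h, rfl⟩, rfl⟩
    exact ⟨w, h, by simp [map_list_prod, Function.comp_def]⟩
  · rintro ⟨w, h, rfl⟩
    exact ⟨_, ⟨w, h, rfl⟩, by simp [map_list_prod, Function.comp_def]⟩

theorem map_mem_wordSpan_iff {B : Type*} [Semiring B] [Algebra R B] {f : A →ₐ[R] B}
    (hf : Function.Injective f) : f x ∈ wordSpan R (fun i => f (g i)) d ↔ x ∈ wordSpan R g d := by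
  rw [← map_wordSpan]
  exact Function.Injective.mem_set_image hf

theorem mul_of_mem_wordSpan {k : A} {ψ : (I → ℤ) → R} (h0 : ψ 0 = 1)
    (hadd : ∀ a b, ψ (a + b) = ψ a * ψ b) (h : ∀ j, k * g j = ψ (sg j) • (g j * k))
    (hx : x ∈ wordSpan R g d) : k * x = ψ d • (x * k) := by
  induction hx using wordSpan_induction with
  | one => simp [h0]
  | letter_mul j d x _ ih =>
    rw [← mul_assoc, h, smul_mul_assoc, mul_assoc, ih, hadd, mul_smul_comm, smul_smul, mul_assoc]
  | zero => simp
  | add d x y _ _ hx hy => rw [mul_add, hx, hy, add_mul, smul_add]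
  | smul d a x _ hx => rw [mul_smul_comm, hx, smul_mul_assoc, smul_comm]

end Words

section WordsOfU

variable {I : Type*} [Fintype I] [DecidableEq I] {D : Datum I} {d : I → ℤ} {x : U D}

theorem Uplus_eq_wordSpan (n : I → ℕ) : Uplus D n = wordSpan Qvt (U.E D) (toZ n) := by
  simp only [Uplus, wordSpan, toZ, funext_iff, Nat.cast_inj]

theorem Uminus_eq_wordSpan (n : I → ℕ) : Uminus D n = wordSpan Qvt (U.F D) (toZ n) := by
  simp only [Uminus, wordSpan, toZ, funext_iff, Nat.cast_inj]

theorem K_mul_of_mem_E (i : I) (hx : x ∈ wordSpan Qvt (U.E D) d) :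
    U.K D i * x = D.brace (sg i) d • (x * U.K D i) :=
  mul_of_mem_wordSpan (D.brace_zero_right _) (D.brace_add_right _) (U.K_E_brace D i) hx

theorem K'_mul_of_mem_E (i : I) (hx : x ∈ wordSpan Qvt (U.E D) d) :
    U.K' D i * x = (D.brace d (sg i))⁻¹ • (x * U.K' D i) :=
  mul_of_mem_wordSpan (ψ := fun d => (D.brace d (sg i))⁻¹) (by rw [D.brace_zero_left, inv_one])
    (fun a b => by rw [D.brace_add_left, mul_inv]) (U.K'_E_brace D i) hx

theorem K_mul_of_mem_F (i : I) (hx : x ∈ wordSpan Qvt (U.F D) d) :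
    U.K D i * x = (D.brace (sg i) d)⁻¹ • (x * U.K D i) :=
  mul_of_mem_wordSpan (ψ := fun d => (D.brace (sg i) d)⁻¹) (by rw [D.brace_zero_right, inv_one])
    (fun a b => by rw [D.brace_add_right, mul_inv]) (U.K_F_brace D i) hx

theorem K'_mul_of_mem_F (i : I) (hx : x ∈ wordSpan Qvt (U.F D) d) :
    U.K' D i * x = D.brace d (sg i) • (x * U.K' D i) :=
  mul_of_mem_wordSpan (ψ := fun d => D.brace d (sg i)) (D.brace_zero_left _)
    (fun a b => D.brace_add_left a b _) (U.K'_F_brace D i) hx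

end WordsOfU

section Contraction

variable {R H : Type*} [CommSemiring R] [Semiring H] [Algebra R H]

/-- The contraction `y ↦ ∑ ξ(y₁) y₂` of a functional `ξ` with the first leg of a
comultiplication. -/
def leftContract (Δ : H →ₐ[R] H ⊗[R] H) (ξ : H →ₗ[R] R) : H →ₗ[R] H :=
  (TensorProduct.lid R H).toLinearMap ∘ₗ ξ.rTensor H ∘ₗ Δ.toLinearMap

/-- The contraction `y ↦ ∑ ξ(y₂) y₁` of a functional `ξ` with the second leg of a
comultiplication. -/
def rightContract (Δ : H →ₐ[R] H ⊗[R] H) (ξ : H →ₗ[R] R) : H →ₗ[R] H :=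
  (TensorProduct.rid R H).toLinearMap ∘ₗ ξ.lTensor H ∘ₗ Δ.toLinearMap

theorem apply_leftContract (Δ : H →ₐ[R] H ⊗[R] H) (ξ ζ : H →ₗ[R] R) (y : H) :
    ζ (leftContract Δ ξ y) = LinearMap.mul' R R (TensorProduct.map ξ ζ (Δ y)) := by
  simp only [leftContract, LinearMap.comp_apply, AlgHom.toLinearMap_apply, LinearEquiv.coe_coe]
  induction Δ y using TensorProduct.induction_on with
  | zero => simp
  | tmul a b => simp
  | add z z' hz hz' => simp only [map_add, hz, hz']

theorem apply_rightContract (Δ : H →ₐ[R] H ⊗[R] H) (ξ ζ : H →ₗ[R] R) (y : H) :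
    ζ (rightContract Δ ξ y) = LinearMap.mul' R R (TensorProduct.map ζ ξ (Δ y)) := by
  simp only [rightContract, LinearMap.comp_apply, AlgHom.toLinearMap_apply, LinearEquiv.coe_coe]
  induction Δ y using TensorProduct.induction_on with
  | zero => simp
  | tmul a b => simp [mul_comm]
  | add z z' hz hz' => simp only [map_add, hz, hz']

theorem leftContract_one (Δ : H →ₐ[R] H ⊗[R] H) (ξ : H →ₗ[R] R) :
    leftContract Δ ξ 1 = ξ 1 • 1 := by
  simp [leftContract, Algebra.TensorProduct.one_def]

theorem rightContract_one (Δ : H →ₐ[R] H ⊗[R] H) (ξ : H →ₗ[R] R) :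
    rightContract Δ ξ 1 = ξ 1 • 1 := by
  simp [rightContract, Algebra.TensorProduct.one_def]

variable {Δ : H →ₐ[R] H ⊗[R] H} {ε ξ : H →ₗ[R] R} {g k : H} {c χ : R}

theorem leftContract_mul (hε : ∀ y, leftContract Δ ε y = y) (hg : Δ g = g ⊗ₜ 1 + k ⊗ₜ g)
    (hξg : ∀ y, ξ (g * y) = c * ε y) (hξk : ∀ y, ξ (k * y) = χ * ξ y) (y : H) :
    leftContract Δ ξ (g * y) = c • y + χ • (g * leftContract Δ ξ y) := by
  conv_rhs => enter [1]; rw [← hε y]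
  simp only [leftContract, LinearMap.comp_apply, AlgHom.toLinearMap_apply, LinearEquiv.coe_coe,
    map_mul, hg]
  induction Δ y using TensorProduct.induction_on with
  | zero => simp
  | tmul a b => simp [add_mul, hξg, hξk, mul_smul]
  | add z z' hz hz' =>
    simp only [mul_add, map_add, hz, hz', smul_add]
    abel

theorem rightContract_mul (hε : ∀ y, rightContract Δ ε y = y) (hg : Δ g = g ⊗ₜ 1 + k ⊗ₜ g)
    (hξg : ∀ y, ξ (g * y) = c * ε y) (y : H) :
    rightContract Δ ξ (g * y) = c • (k * y) + g * rightContract Δ ξ y := by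
  conv_rhs => enter [1]; rw [← hε y]
  simp only [rightContract, LinearMap.comp_apply, AlgHom.toLinearMap_apply, LinearEquiv.coe_coe,
    map_mul, hg]
  induction Δ y using TensorProduct.induction_on with
  | zero => simp
  | tmul a b => simp [add_mul, hξg, mul_smul, add_comm]
  | add z z' hz hz' =>
    simp only [mul_add, map_add, hz, hz', smul_add]
    abel

end Contraction

section SkewDerivations

variable {R I H : Type*} [CommSemiring R] [DecidableEq I] [Semiring H] [Algebra R H]

/-- A linear map which behaves on words in the letters `g j` like a derivation sending `g i` to `c`
and the other letters to `0`, twisted by the character `χ` when it moves past a letter. -/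
structure IsLeftSkewDer (g : I → H) (i : I) (c : R) (χ : I → R) (L : H →ₗ[R] H) : Prop where
  map_one : L 1 = 0
  map_letter_mul (j : I) (y : H) :
    L (g j * y) = (if i = j then c else 0) • y + χ j • (g j * L y)

/-- A linear map which behaves on words in the letters `g j` like a derivation sending `g i` to
`c • k` and the other letters to `0`. -/
structure IsRightSkewDer (g : I → H) (i : I) (c : R) (k : H) (S : H →ₗ[R] H) : Prop where
  map_one : S 1 = 0
  map_letter_mul (j : I) (y : H) :
    S (g j * y) = (if i = j then c else 0) • (k * y) + g j * S y

section

variable {Δ : H →ₐ[R] H ⊗[R] H} {ε ξ : H →ₗ[R] R} {g k : I → H} {i : I} {c : R} {χ : I → R}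

theorem isLeftSkewDer_leftContract (hε : ∀ y, leftContract Δ ε y = y)
    (hg : ∀ j, Δ (g j) = g j ⊗ₜ 1 + k j ⊗ₜ g j) (hξ1 : ξ 1 = 0)
    (hξg : ∀ j y, ξ (g j * y) = (if i = j then c else 0) * ε y)
    (hξk : ∀ j y, ξ (k j * y) = χ j * ξ y) : IsLeftSkewDer g i c χ (leftContract Δ ξ) where
  map_one := by rw [leftContract_one, hξ1, zero_smul]
  map_letter_mul j := leftContract_mul hε (hg j) (hξg j) (hξk j)

theorem isRightSkewDer_rightContract (hε : ∀ y, rightContract Δ ε y = y)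
    (hg : ∀ j, Δ (g j) = g j ⊗ₜ 1 + k j ⊗ₜ g j) (hξ1 : ξ 1 = 0)
    (hξg : ∀ j y, ξ (g j * y) = (if i = j then c else 0) * ε y) :
    IsRightSkewDer g i c (k i) (rightContract Δ ξ) where
  map_one := by rw [rightContract_one, hξ1, zero_smul]
  map_letter_mul j y := by
    rw [rightContract_mul hε (hg j) (hξg j)]
    rcases eq_or_ne i j with rfl | hij
    · rfl
    · simp only [if_neg hij, zero_smul]

end

variable {g : I → H} {i : I} {c : R} {χ : I → R} {k : H} {L S : H →ₗ[R] H} {d : I → ℤ} {y : H}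

theorem IsLeftSkewDer.apply_mem (hL : IsLeftSkewDer g i c χ L) (hy : y ∈ wordSpan R g d) :
    L y ∈ wordSpan R g (d - sg i) := by
  induction hy using wordSpan_induction with
  | one => rw [hL.map_one]; exact zero_mem _
  | letter_mul j d y hy ih =>
    rw [hL.map_letter_mul]
    refine add_mem ?_ (Submodule.smul_mem _ _ (add_sub_assoc (sg j) d (sg i) ▸
      letter_mul_mem_wordSpan j ih))
    split_ifs with hij
    · exact Submodule.smul_mem _ _ (by rwa [hij, add_sub_cancel_left])
    · simp
  | zero => simp
  | add d x y _ _ hx hy => rw [map_add]; exact add_mem hx hy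
  | smul d a y _ hy => rw [map_smul]; exact Submodule.smul_mem _ a hy

theorem IsRightSkewDer.apply_mem (hS : IsRightSkewDer g i c k S) {ψ : (I → ℤ) → R}
    (hk : ∀ {d y}, y ∈ wordSpan R g d → k * y = ψ d • (y * k)) (hy : y ∈ wordSpan R g d) :
    S y ∈ (wordSpan R g (d - sg i)).map (LinearMap.mulRight R k) := by
  induction hy using wordSpan_induction with
  | one => rw [hS.map_one]; exact zero_mem _
  | letter_mul j d y hy ih =>
    rw [hS.map_letter_mul]
    refine add_mem ?_ ?_
    · split_ifs with hij
      · rw [hk hy]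
        refine Submodule.smul_mem _ _ (Submodule.smul_mem _ _ ⟨y, ?_, rfl⟩)
        rwa [hij, add_sub_cancel_left]
      · rw [zero_smul]; exact zero_mem _
    · obtain ⟨p, hp, hpk⟩ := ih
      rw [← hpk, add_sub_assoc]
      exact ⟨g j * p, letter_mul_mem_wordSpan j hp, mul_assoc _ _ _⟩
  | zero => rw [map_zero]; exact zero_mem _
  | add d x y _ _ hx hy => rw [map_add]; exact add_mem hx hy
  | smul d a y _ hy => rw [map_smul]; exact Submodule.smul_mem _ a hy

/-- Moving `x` through a word leaves a term `f k - κ` at each letter: `S` collects the terms with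
`k`, and `L` those with `κ`, once `κ` has been moved to the left end of the word. -/
theorem commutator_eq_of_mem_wordSpan {A : Type*} [Ring A] [Algebra R A] {f : H →ₐ[R] A} {x κ : A}
    (hL : IsLeftSkewDer g i c χ L) (hS : IsRightSkewDer g i c k S)
    (hx : ∀ j, x * f (g j) - f (g j) * x = (if i = j then c else 0) • (f k - κ))
    (hκ : ∀ j, χ j • (κ * f (g j)) = f (g j) * κ) (hy : y ∈ wordSpan R g d) :
    x * f y - f y * x = f (S y) - κ * f (L y) := by
  induction hy using wordSpan_induction with
  | one => simp [hL.map_one, hS.map_one]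
  | letter_mul j _ y _ ih =>
    have leibniz : x * f (g j * y) - f (g j * y) * x =
        (x * f (g j) - f (g j) * x) * f y + f (g j) * (x * f y - f y * x) := by
      rw [map_mul]; noncomm_ring
    rw [leibniz, hx, ih, hS.map_letter_mul, hL.map_letter_mul]
    simp only [map_add, map_smul, map_mul, mul_add, mul_smul_comm, smul_mul_assoc, sub_mul,
      smul_sub, mul_sub]
    rw [← mul_assoc κ (f (g j)), ← smul_mul_assoc (χ j), hκ, mul_assoc]
    abel
  | zero => simp
  | add _ y z _ _ hy hz =>
    simp only [map_add, mul_add, add_mul]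
    rw [add_sub_add_comm, hy, hz, add_sub_add_comm]
  | smul _ a y _ hy =>
    simp only [map_smul, mul_smul_comm, smul_mul_assoc, ← smul_sub, hy]

end SkewDerivations

section RestrictComul

variable {𝕜 A : Type*} [Field 𝕜] [Ring A] [Algebra 𝕜 A]

theorem map_val_injective (S : Subalgebra 𝕜 A) :
    Function.Injective (Algebra.TensorProduct.map S.val S.val) :=
  TensorProduct.map_injective_of_flat_flat S.val.toLinearMap S.val.toLinearMap
    Subtype.val_injective Subtype.val_injective

/-- The restriction of a comultiplication `Δ` to a subalgebra `S` with `Δ(S) ⊆ S ⊗ S`. -/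
def restrictComul (Δ : A →ₐ[𝕜] A ⊗[𝕜] A) (S : Subalgebra 𝕜 A)
    (hS : S ≤ (Algebra.TensorProduct.map S.val S.val).range.comap Δ) : S →ₐ[𝕜] S ⊗[𝕜] S :=
  (AlgEquiv.ofInjective _ (map_val_injective S)).symm.toAlgHom.comp
    ((Δ.comp S.val).codRestrict _ fun x => hS x.2)

variable {Δ : A →ₐ[𝕜] A ⊗[𝕜] A} {S : Subalgebra 𝕜 A}
  (hS : S ≤ (Algebra.TensorProduct.map S.val S.val).range.comap Δ)

theorem map_val_restrictComul (x : S) :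
    Algebra.TensorProduct.map S.val S.val (restrictComul Δ S hS x) = Δ x :=
  congrArg Subtype.val ((AlgEquiv.ofInjective _ (map_val_injective S)).apply_symm_apply _)

theorem restrictComul_eq {x : S} {z : S ⊗[𝕜] S}
    (h : Algebra.TensorProduct.map S.val S.val z = Δ x) : restrictComul Δ S hS x = z :=
  map_val_injective S ((map_val_restrictComul hS x).trans h.symm)

theorem coe_leftContract_restrictComul (ε : A →ₗ[𝕜] 𝕜) (x : S) :
    (leftContract (restrictComul Δ S hS) (ε ∘ₗ S.val.toLinearMap) x : A) = leftContract Δ ε x := by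
  simp only [leftContract, LinearMap.comp_apply, AlgHom.toLinearMap_apply,
    ← map_val_restrictComul hS]
  induction restrictComul Δ S hS x using TensorProduct.induction_on with
  | zero => simp
  | tmul a b => simp
  | add z z' hz hz' => simp only [map_add, AddMemClass.coe_add, hz, hz']

theorem coe_rightContract_restrictComul (ε : A →ₗ[𝕜] 𝕜) (x : S) :
    (rightContract (restrictComul Δ S hS) (ε ∘ₗ S.val.toLinearMap) x : A) =
      rightContract Δ ε x := by
  simp only [rightContract, LinearMap.comp_apply, AlgHom.toLinearMap_apply,
    ← map_val_restrictComul hS]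
  induction restrictComul Δ S hS x using TensorProduct.induction_on with
  | zero => simp
  | tmul a b => simp
  | add z z' hz hz' => simp only [map_add, AddMemClass.coe_add, hz, hz']

end RestrictComul

theorem noncommProd_zpow_sg {I G : Type*} [DecidableEq I] [Monoid G] (u : I → Gˣ) (i : I)
    (s : Finset I) (h : (s : Set I).Pairwise
      (Function.onFun Commute fun j => ((u j ^ (sg i j) : Gˣ) : G))) :
    s.noncommProd (fun j => ((u j ^ (sg i j) : Gˣ) : G)) h
      = ((if i ∈ s then u i else 1 : Gˣ) : G) := by
  induction s using Finset.induction_on with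
  | empty => simp
  | insert j s hj ih =>
    rw [Finset.noncommProd_insert_of_notMem _ _ _ _ hj, ih]
    rcases eq_or_ne i j with rfl | hij
    · simp [sg, hj]
    · simp [sg, hij, hij.symm]

section Borel

variable {I : Type*} [Fintype I] [DecidableEq I] (D : Datum I)

theorem comul_gen (x : Gen I) : comul D (U.gen D x) = comulGen D x := U.lift_gen D _ _ x

theorem counit_gen (x : Gen I) : counit D (U.gen D x) = counitGen x := U.lift_gen D _ _ x

theorem U.algHom_ext {A : Type*} [Semiring A] [Algebra Qvt A] {f g : U D →ₐ[Qvt] A}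
    (h : ∀ x, f (U.gen D x) = g (U.gen D x)) : f = g :=
  RingQuot.ringQuot_ext' _ _ _ (FreeAlgebra.hom_ext (funext h))

theorem leftContract_comul_counit (x : U D) :
    leftContract (comul D) (counit D).toLinearMap x = x := by
  have : ((Algebra.TensorProduct.lid Qvt (U D)).toAlgHom.comp
      (Algebra.TensorProduct.map (counit D) (AlgHom.id Qvt (U D)))).comp (comul D) =
        AlgHom.id Qvt (U D) :=
    U.algHom_ext D fun x => by
      cases x <;> simp [comul_gen, comulGen, counit_gen, counitGen, U.E, U.F, U.K, U.Kinv, U.K',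
        U.K'inv]
  exact DFunLike.congr_fun this x

theorem rightContract_comul_counit (x : U D) :
    rightContract (comul D) (counit D).toLinearMap x = x := by
  have : ((Algebra.TensorProduct.rid Qvt Qvt (U D)).toAlgHom.comp
      (Algebra.TensorProduct.map (AlgHom.id Qvt (U D)) (counit D))).comp (comul D) =
        AlgHom.id Qvt (U D) :=
    U.algHom_ext D fun x => by
      cases x <;> simp [comul_gen, comulGen, counit_gen, counitGen, U.E, U.F, U.K, U.Kinv, U.K',
        U.K'inv]
  exact DFunLike.congr_fun this x

/-- The opposite comultiplication. It puts `F_i` on the same footing as `E_i`: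
`Δᵒᵖ(F_i) = F_i ⊗ 1 + K'_i ⊗ F_i`. -/
def comulOp : U D →ₐ[Qvt] U D ⊗[Qvt] U D :=
  (Algebra.TensorProduct.comm Qvt (U D) (U D)).toAlgHom.comp (comul D)

theorem leftContract_comulOp (ξ : U D →ₗ[Qvt] Qvt) :
    leftContract (comulOp D) ξ = rightContract (comul D) ξ := by
  ext x
  simp only [leftContract, rightContract, comulOp, LinearMap.comp_apply, AlgHom.toLinearMap_apply,
    AlgHom.comp_apply]
  induction comul D x using TensorProduct.induction_on with
  | zero => simp
  | tmul a b => simp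
  | add z z' hz hz' => simp only [map_add, hz, hz']

theorem rightContract_comulOp (ξ : U D →ₗ[Qvt] Qvt) :
    rightContract (comulOp D) ξ = leftContract (comul D) ξ := by
  ext x
  simp only [leftContract, rightContract, comulOp, LinearMap.comp_apply, AlgHom.toLinearMap_apply,
    AlgHom.comp_apply]
  induction comul D x using TensorProduct.induction_on with
  | zero => simp
  | tmul a b => simp
  | add z z' hz hz' => simp only [map_add, hz, hz']

theorem coe_Kgeq_sg (i : I) : (Kgeq D (sg i) : U D) = U.K D i :=
  (noncommProd_zpow_sg (Kunit D) i _ (Kunit_comm D _ _)).trans <| by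
    rw [if_pos (Finset.mem_univ i)]; rfl

theorem coe_K'leq_sg (i : I) : (K'leq D (sg i) : U D) = U.K' D i :=
  (noncommProd_zpow_sg (K'unit D) i _ (K'unit_comm D _ _)).trans <| by
    rw [if_pos (Finset.mem_univ i)]; rfl

theorem Kgeq_zero : Kgeq D 0 = 1 := Subtype.ext <|
  (Finset.noncommProd_eq_pow_card _ _ (Kunit_comm D 0 _) 1 (by simp)).trans (one_pow _)

theorem K'leq_zero : K'leq D 0 = 1 := Subtype.ext <|
  (Finset.noncommProd_eq_pow_card _ _ (K'unit_comm D 0 _) 1 (by simp)).trans (one_pow _)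

/-- `E_i` as an element of `U_{≥0}`. -/
def Egeq (i : I) : Ugeq D := ⟨U.E D i, E_mem D i⟩

/-- `F_i` as an element of `U_{≤0}`. -/
def Fleq (i : I) : Uleq D := ⟨U.F D i, F_mem D i⟩

variable {D} in
theorem coe_mem_wordSpan_E {x : Ugeq D} {d : I → ℤ} :
    (x : U D) ∈ wordSpan Qvt (U.E D) d ↔ x ∈ wordSpan Qvt (Egeq D) d :=
  map_mem_wordSpan_iff (f := (Ugeq D).val) (g := Egeq D) Subtype.val_injective

variable {D} in
theorem coe_mem_wordSpan_F {y : Uleq D} {d : I → ℤ} :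
    (y : U D) ∈ wordSpan Qvt (U.F D) d ↔ y ∈ wordSpan Qvt (Fleq D) d :=
  map_mem_wordSpan_iff (f := (Uleq D).val) (g := Fleq D) Subtype.val_injective

theorem Ugeq_le_comap_comul : Ugeq D ≤
    (Algebra.TensorProduct.map (Ugeq D).val (Ugeq D).val).range.comap (comul D) := by
  refine Algebra.adjoin_le ?_
  rintro _ ((⟨i, rfl⟩ | ⟨i, rfl⟩) | ⟨i, rfl⟩)
  · exact ⟨Egeq D i ⊗ₜ 1 + Kgeq D (sg i) ⊗ₜ Egeq D i, by
      simp [U.E, comul_gen, comulGen, Egeq, coe_Kgeq_sg]⟩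
  · exact ⟨Kgeq D (sg i) ⊗ₜ Kgeq D (sg i), by simp [U.K, comul_gen, comulGen, coe_Kgeq_sg]⟩
  · let Kinv : Ugeq D := ⟨U.Kinv D i, Algebra.subset_adjoin (Or.inr ⟨i, rfl⟩)⟩
    exact ⟨Kinv ⊗ₜ Kinv, by simp [U.Kinv, comul_gen, comulGen, Kinv]⟩

theorem Uleq_le_comap_comulOp : Uleq D ≤
    (Algebra.TensorProduct.map (Uleq D).val (Uleq D).val).range.comap (comulOp D) := by
  refine Algebra.adjoin_le ?_
  rintro _ ((⟨i, rfl⟩ | ⟨i, rfl⟩) | ⟨i, rfl⟩)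
  · exact ⟨Fleq D i ⊗ₜ 1 + K'leq D (sg i) ⊗ₜ Fleq D i, by
      simp [U.F, comulOp, comul_gen, comulGen, Fleq, coe_K'leq_sg]⟩
  · exact ⟨K'leq D (sg i) ⊗ₜ K'leq D (sg i), by
      simp [U.K', comulOp, comul_gen, comulGen, coe_K'leq_sg]⟩
  · let K'inv : Uleq D := ⟨U.K'inv D i, Algebra.subset_adjoin (Or.inr ⟨i, rfl⟩)⟩
    exact ⟨K'inv ⊗ₜ K'inv, by simp [U.K'inv, comulOp, comul_gen, comulGen, K'inv]⟩

/-- The comultiplication of `U_{≥0}`. -/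
def comulGeq : Ugeq D →ₐ[Qvt] Ugeq D ⊗[Qvt] Ugeq D :=
  restrictComul (comul D) (Ugeq D) (Ugeq_le_comap_comul D)

/-- The opposite comultiplication of `U_{≤0}`. -/
def comulLeqOp : Uleq D →ₐ[Qvt] Uleq D ⊗[Qvt] Uleq D :=
  restrictComul (comulOp D) (Uleq D) (Uleq_le_comap_comulOp D)

/-- The counit of `U_{≥0}`. -/
def counitGeq : Ugeq D →ₗ[Qvt] Qvt := (counit D).toLinearMap ∘ₗ (Ugeq D).val.toLinearMap

/-- The counit of `U_{≤0}`. -/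
def counitLeq : Uleq D →ₗ[Qvt] Qvt := (counit D).toLinearMap ∘ₗ (Uleq D).val.toLinearMap

theorem comulGeq_E (i : I) : comulGeq D (Egeq D i) = Egeq D i ⊗ₜ 1 + Kgeq D (sg i) ⊗ₜ Egeq D i :=
  restrictComul_eq _ (by simp [U.E, comul_gen, comulGen, Egeq, coe_Kgeq_sg])

theorem comulLeqOp_F (i : I) :
    comulLeqOp D (Fleq D i) = Fleq D i ⊗ₜ 1 + K'leq D (sg i) ⊗ₜ Fleq D i :=
  restrictComul_eq _ (by simp [U.F, comulOp, comul_gen, comulGen, Fleq, coe_K'leq_sg])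

theorem leftContract_comulGeq_counit (x : Ugeq D) :
    leftContract (comulGeq D) (counitGeq D) x = x :=
  Subtype.ext <| (coe_leftContract_restrictComul _ _ _).trans (leftContract_comul_counit D x)

theorem rightContract_comulGeq_counit (x : Ugeq D) :
    rightContract (comulGeq D) (counitGeq D) x = x :=
  Subtype.ext <| (coe_rightContract_restrictComul _ _ _).trans (rightContract_comul_counit D x)

theorem leftContract_comulLeqOp_counit (y : Uleq D) :
    leftContract (comulLeqOp D) (counitLeq D) y = y :=
  Subtype.ext <| (coe_leftContract_restrictComul _ _ _).trans <| by
    rw [leftContract_comulOp, rightContract_comul_counit]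

theorem rightContract_comulLeqOp_counit (y : Uleq D) :
    rightContract (comulLeqOp D) (counitLeq D) y = y :=
  Subtype.ext <| (coe_rightContract_restrictComul _ _ _).trans <| by
    rw [rightContract_comulOp, leftContract_comul_counit]

end Borel

section Pairing

variable {I : Type*} [Fintype I] [DecidableEq I] {D : Datum I}

/-- The adjoint of left multiplication by `E_i` under the pairing `φ`. -/
def adjMulLeftE (φ : Ugeq D →ₗ[Qvt] Uleq D →ₗ[Qvt] Qvt) (i : I) : Uleq D →ₗ[Qvt] Uleq D :=
  leftContract (comulLeqOp D) (φ (Egeq D i))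

/-- The adjoint of right multiplication by `E_i` under the pairing `φ`. -/
def adjMulRightE (φ : Ugeq D →ₗ[Qvt] Uleq D →ₗ[Qvt] Qvt) (i : I) : Uleq D →ₗ[Qvt] Uleq D :=
  rightContract (comulLeqOp D) (φ (Egeq D i))

/-- The adjoint of left multiplication by `F_i` under the pairing `φ`. -/
def adjMulLeftF (φ : Ugeq D →ₗ[Qvt] Uleq D →ₗ[Qvt] Qvt) (i : I) : Ugeq D →ₗ[Qvt] Ugeq D :=
  leftContract (comulGeq D) (φ.flip (Fleq D i))

/-- The adjoint of right multiplication by `F_i` under the pairing `φ`. -/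
def adjMulRightF (φ : Ugeq D →ₗ[Qvt] Uleq D →ₗ[Qvt] Qvt) (i : I) : Ugeq D →ₗ[Qvt] Ugeq D :=
  rightContract (comulGeq D) (φ.flip (Fleq D i))

namespace IsSkewHopfPairing

variable {φ : Ugeq D →ₗ[Qvt] Uleq D →ₗ[Qvt] Qvt} (h : IsSkewHopfPairing D φ) {d e : I → ℤ}
include h

theorem mul_apply (x x' : Ugeq D) (y : Uleq D) : φ (x * x') y =
    LinearMap.mul' Qvt Qvt (TensorProduct.map (φ x) (φ x') (comulLeqOp D y)) := by
  have hz : TensorProduct.map (Uleq D).val.toLinearMap (Uleq D).val.toLinearMap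
      (TensorProduct.comm Qvt _ _ (comulLeqOp D y)) = comul D y := by
    rw [TensorProduct.map_comm]
    refine (congrArg (TensorProduct.comm Qvt (U D) (U D))
      (map_val_restrictComul (Uleq_le_comap_comulOp D) y)).trans ?_
    exact (TensorProduct.comm Qvt (U D) (U D)).symm_apply_apply (comul D y)
  rw [h.mul_left x x' y _ hz, TensorProduct.comm_comm]

theorem apply_mul (x : Ugeq D) (y y' : Uleq D) : φ x (y * y') =
    LinearMap.mul' Qvt Qvt (TensorProduct.map (φ.flip y) (φ.flip y') (comulGeq D x)) :=
  h.mul_right x y y' _ (map_val_restrictComul (Ugeq_le_comap_comul D) x)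

theorem apply_adjMulLeftE (i : I) (x : Ugeq D) (y : Uleq D) :
    φ x (adjMulLeftE φ i y) = φ (Egeq D i * x) y := by
  rw [adjMulLeftE, apply_leftContract, h.mul_apply]

theorem apply_adjMulRightE (i : I) (x : Ugeq D) (y : Uleq D) :
    φ x (adjMulRightE φ i y) = φ (x * Egeq D i) y := by
  rw [adjMulRightE, apply_rightContract, h.mul_apply]

theorem adjMulLeftF_apply (i : I) (x : Ugeq D) (y : Uleq D) :
    φ (adjMulLeftF φ i x) y = φ x (Fleq D i * y) := by
  rw [adjMulLeftF, ← LinearMap.flip_apply, apply_leftContract, h.apply_mul]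

theorem adjMulRightF_apply (i : I) (x : Ugeq D) (y : Uleq D) :
    φ (adjMulRightF φ i x) y = φ x (y * Fleq D i) := by
  rw [adjMulRightF, ← LinearMap.flip_apply, apply_rightContract, h.apply_mul]

theorem apply_E_one (i : I) : φ (Egeq D i) 1 = 0 := (h.one_right _).trans (counit_gen D (.E i))

theorem apply_one_F (i : I) : φ 1 (Fleq D i) = 0 := (h.one_left _).trans (counit_gen D (.F i))

theorem K_K'_wordSpan (m n : I → ℤ) {x : Ugeq D} {y : Uleq D} (hx : x ∈ wordSpan Qvt (Egeq D) d)
    (hy : y ∈ wordSpan Qvt (Fleq D) e) :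
    φ (Kgeq D m * x) (K'leq D n * y) = D.brace m n * D.brace m e * D.brace d n * φ x y := by
  by_cases hd : ∃ a, toZ a = d
  · by_cases he : ∃ b, toZ b = e
    · obtain ⟨a, rfl⟩ := hd
      obtain ⟨b, rfl⟩ := he
      exact h.K_K' m n a b x y (by rwa [Uplus_eq_wordSpan, coe_mem_wordSpan_E])
        (by rwa [Uminus_eq_wordSpan, coe_mem_wordSpan_F])
    · rw [wordSpan_eq_bot (not_exists.1 he), Submodule.mem_bot] at hy
      simp [hy]
  · rw [wordSpan_eq_bot (not_exists.1 hd), Submodule.mem_bot] at hx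
    simp [hx]

theorem apply_Kgeq_K'leq (m n : I → ℤ) : φ (Kgeq D m) (K'leq D n) = D.brace m n := by
  have apply_one_one : φ 1 1 = 1 := by simp [h.one_left]
  simpa [apply_one_one, D.brace_zero_left, D.brace_zero_right] using
    h.K_K'_wordSpan m n one_mem_wordSpan one_mem_wordSpan

theorem apply_Kgeq_F (m : I → ℤ) (j : I) : φ (Kgeq D m) (Fleq D j) = 0 := by
  simpa [h.apply_one_F, K'leq_zero] using
    h.K_K'_wordSpan m 0 one_mem_wordSpan (letter_mem_wordSpan j)

theorem apply_E_K'leq (i : I) (n : I → ℤ) : φ (Egeq D i) (K'leq D n) = 0 := by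
  simpa [h.apply_E_one, Kgeq_zero] using
    h.K_K'_wordSpan 0 n (letter_mem_wordSpan i) one_mem_wordSpan

theorem apply_E_F (i j : I) : φ (Egeq D i) (Fleq D j) = if i = j then D.pairEF i else 0 := h.E_F i j

theorem apply_E_F' (i j : I) : φ (Egeq D j) (Fleq D i) = if i = j then D.pairEF i else 0 := by
  rw [h.apply_E_F]
  rcases eq_or_ne i j with rfl | hij
  · rfl
  · rw [if_neg hij, if_neg hij.symm]

theorem apply_E_mul (i : I) (y y' : Uleq D) : φ (Egeq D i) (y * y') =
    φ (Egeq D i) y * counitLeq D y' + φ (Kgeq D (sg i)) y * φ (Egeq D i) y' := by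
  simp [h.apply_mul, comulGeq_E, h.one_left, counitLeq]

theorem mul_apply_F (i : I) (x x' : Ugeq D) : φ (x * x') (Fleq D i) =
    φ x (Fleq D i) * counitGeq D x' + φ x (K'leq D (sg i)) * φ x' (Fleq D i) := by
  simp [h.mul_apply, comulLeqOp_F, h.one_right, counitGeq]

theorem isLeftSkewDer_adjMulLeftE (i : I) : IsLeftSkewDer (Fleq D) i (D.pairEF i)
    (fun j => D.brace (sg i) (sg j)) (adjMulLeftE φ i) :=
  isLeftSkewDer_leftContract (leftContract_comulLeqOp_counit D) (comulLeqOp_F D)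
    (h.apply_E_one i) (fun j y => by
      rw [h.apply_E_mul, h.apply_Kgeq_F, zero_mul, add_zero, h.apply_E_F])
    fun j y => by rw [h.apply_E_mul, h.apply_E_K'leq, zero_mul, zero_add, h.apply_Kgeq_K'leq]

theorem isRightSkewDer_adjMulRightE (i : I) : IsRightSkewDer (Fleq D) i (D.pairEF i)
    (K'leq D (sg i)) (adjMulRightE φ i) :=
  isRightSkewDer_rightContract (k := fun j => K'leq D (sg j)) (rightContract_comulLeqOp_counit D)
    (comulLeqOp_F D) (h.apply_E_one i) fun j y => by
      rw [h.apply_E_mul, h.apply_Kgeq_F, zero_mul, add_zero, h.apply_E_F]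

theorem isLeftSkewDer_adjMulLeftF (i : I) : IsLeftSkewDer (Egeq D) i (D.pairEF i)
    (fun j => D.brace (sg j) (sg i)) (adjMulLeftF φ i) :=
  isLeftSkewDer_leftContract (leftContract_comulGeq_counit D) (comulGeq_E D)
    (h.apply_one_F i) (fun j x => by
      rw [LinearMap.flip_apply, h.mul_apply_F, h.apply_E_K'leq, zero_mul, add_zero, h.apply_E_F'])
    fun j x => by
      simp only [LinearMap.flip_apply]
      rw [h.mul_apply_F, h.apply_Kgeq_F, zero_mul, zero_add, h.apply_Kgeq_K'leq]

theorem isRightSkewDer_adjMulRightF (i : I) : IsRightSkewDer (Egeq D) i (D.pairEF i)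
    (Kgeq D (sg i)) (adjMulRightF φ i) :=
  isRightSkewDer_rightContract (k := fun j => Kgeq D (sg j)) (rightContract_comulGeq_counit D)
    (comulGeq_E D) (h.apply_one_F i) fun j x => by
      rw [LinearMap.flip_apply, h.mul_apply_F, h.apply_E_K'leq, zero_mul, add_zero, h.apply_E_F']

theorem E_commutator (i : I) {y : Uleq D} (hy : y ∈ wordSpan Qvt (Fleq D) d) :
    U.E D i * (y : U D) - y * U.E D i = adjMulRightE φ i y - U.K D i * (adjMulLeftE φ i y : U D) :=
  commutator_eq_of_mem_wordSpan (f := (Uleq D).val) (h.isLeftSkewDer_adjMulLeftE i)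
    (h.isRightSkewDer_adjMulRightE i)
    (fun j => (U.E_F_pairEF D i j).trans (by rw [← coe_K'leq_sg]; rfl))
    (fun j => by
      change D.brace (sg i) (sg j) • (U.K D i * U.F D j) = U.F D j * U.K D i
      rw [U.K_F_brace, smul_inv_smul₀ (D.brace_ne_zero _ _)]) hy

theorem F_commutator (i : I) {x : Ugeq D} (hx : x ∈ wordSpan Qvt (Egeq D) d) :
    U.F D i * (x : U D) - x * U.F D i =
      adjMulRightF φ i x - U.K' D i * (adjMulLeftF φ i x : U D) :=
  commutator_eq_of_mem_wordSpan (f := (Ugeq D).val) (h.isLeftSkewDer_adjMulLeftF i)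
    (h.isRightSkewDer_adjMulRightF i)
    (fun j => (U.F_E_pairEF D i j).trans (by rw [← coe_Kgeq_sg]; rfl))
    (fun j => by
      change D.brace (sg j) (sg i) • (U.K' D i * U.E D j) = U.E D j * U.K' D i
      rw [U.K'_E_brace, smul_inv_smul₀ (D.brace_ne_zero _ _)]) hx

end IsSkewHopfPairing

end Pairing

section CanonicalElement

theorem sum_tmul_eq_sum_tmul {R M N ι κ : Type*} [CommSemiring R] [AddCommMonoid M]
    [AddCommMonoid N] [Module R M] [Module R N] [Fintype ι] [Fintype κ] {a : κ → ι → R}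
    {p : ι → M} {c : κ → M} {b : ι → N} {e : κ → N} (hp : ∀ k, p k = ∑ l, a l k • c l)
    (he : ∀ l, e l = ∑ k, a l k • b k) : ∑ k, p k ⊗ₜ[R] b k = ∑ l, c l ⊗ₜ[R] e l := by
  simp only [hp, he, TensorProduct.sum_tmul, TensorProduct.tmul_sum, TensorProduct.smul_tmul]
  exact Finset.sum_comm

theorem toZ_injective {I : Type*} : Function.Injective (toZ : (I → ℕ) → I → ℤ) := fun _ _ h =>
  funext fun i => Nat.cast_injective (R := ℤ) (congrFun h i)

theorem toZ_ne_sub_sg {I : Type*} [DecidableEq I] {d : I → ℤ} (hd : ∀ n : I → ℕ, toZ n ≠ d) (i : I)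
    (n : I → ℕ) : toZ n ≠ d - sg i := fun h => by
  refine hd (n + Pi.single i 1) (funext fun k => ?_)
  have := congrFun h k
  simp only [toZ, sg, Pi.sub_apply, Pi.add_apply, Pi.single_apply] at this ⊢
  grind

variable {I : Type*} [Fintype I] [DecidableEq I] {D : Datum I}

namespace IsSkewHopfPairing

variable {φ : Ugeq D →ₗ[Qvt] Uleq D →ₗ[Qvt] Qvt} (h : IsSkewHopfPairing D φ) {d : I → ℤ}
  {x : Ugeq D} {y : Uleq D} (i : I)
include h

theorem apply_mul_K'leq (hx : x ∈ wordSpan Qvt (Egeq D) d) (hy : y ∈ wordSpan Qvt (Fleq D) d) :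
    φ x (y * K'leq D (sg i)) = φ x y := by
  have comm : K'leq D (sg i) * y = D.brace d (sg i) • (y * K'leq D (sg i)) := Subtype.ext <| by
    simpa [coe_K'leq_sg] using K'_mul_of_mem_F i (coe_mem_wordSpan_F.2 hy)
  have apply_K'leq_mul := h.K_K'_wordSpan 0 (sg i) hx hy
  rw [comm, Kgeq_zero, one_mul, map_smul, D.brace_zero_left, D.brace_zero_left, one_mul, one_mul,
    smul_eq_mul] at apply_K'leq_mul
  exact mul_left_cancel₀ (D.brace_ne_zero _ _) apply_K'leq_mul

theorem mul_Kgeq_apply (hx : x ∈ wordSpan Qvt (Egeq D) d) (hy : y ∈ wordSpan Qvt (Fleq D) d) :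
    φ (x * Kgeq D (sg i)) y = φ x y := by
  have comm : Kgeq D (sg i) * x = D.brace (sg i) d • (x * Kgeq D (sg i)) := Subtype.ext <| by
    simpa [coe_Kgeq_sg] using K_mul_of_mem_E i (coe_mem_wordSpan_E.2 hx)
  have Kgeq_mul_apply := h.K_K'_wordSpan (sg i) 0 hx hy
  rw [comm, K'leq_zero, one_mul, map_smul, LinearMap.smul_apply, D.brace_zero_right,
    D.brace_zero_right, one_mul, mul_one, smul_eq_mul] at Kgeq_mul_apply
  exact mul_left_cancel₀ (D.brace_ne_zero _ _) Kgeq_mul_apply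

theorem adjMulRightE_mem (hy : y ∈ wordSpan Qvt (Fleq D) d) : adjMulRightE φ i y ∈
    (wordSpan Qvt (Fleq D) (d - sg i)).map (LinearMap.mulRight Qvt (K'leq D (sg i))) :=
  (h.isRightSkewDer_adjMulRightE i).apply_mem (ψ := fun d => D.brace d (sg i))
    (fun hy => Subtype.ext <| by
      simpa [coe_K'leq_sg] using K'_mul_of_mem_F i (coe_mem_wordSpan_F.2 hy)) hy

theorem adjMulRightF_mem (hx : x ∈ wordSpan Qvt (Egeq D) d) : adjMulRightF φ i x ∈
    (wordSpan Qvt (Egeq D) (d - sg i)).map (LinearMap.mulRight Qvt (Kgeq D (sg i))) :=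
  (h.isRightSkewDer_adjMulRightF i).apply_mem (ψ := fun d => D.brace (sg i) d)
    (fun hx => Subtype.ext <| by
      simpa [coe_Kgeq_sg] using K_mul_of_mem_E i (coe_mem_wordSpan_E.2 hx)) hx

end IsSkewHopfPairing

namespace DualBases

variable (B : DualBases D)

instance (n : I → ℕ) : Fintype (B.ix n) := B.fin n

theorem nonempty_ix_zero : Nonempty (B.ix 0) := by
  by_contra hn
  rw [not_nonempty_iff] at hn
  have one_ne_zero : (1 : U D) ≠ 0 := fun h => by simpa using congrArg (counit D) h
  have one_mem : (1 : U D) ∈ Uplus D 0 := Submodule.subset_span ⟨[], rfl, rfl⟩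
  have := (B.bs 0).repr.toEquiv.subsingleton
  exact one_ne_zero (congrArg Subtype.val (Subsingleton.elim (⟨1, one_mem⟩ : Uplus D 0) 0))

/- `pairing D` is zero if there is no skew-Hopf pairing, and then no bases are dual under it. -/
theorem isSkewHopfPairing (B : DualBases D) : IsSkewHopfPairing D (pairing D) := by
  by_cases h : ∃ φ, IsSkewHopfPairing D φ
  · rw [pairing, dif_pos h]
    exact h.choose_spec
  · obtain ⟨k⟩ := B.nonempty_ix_zero
    have := B.dual 0 k k
    rw [pairing, dif_neg h] at this
    simp at this

/-- The basis vectors of `U⁻`, as elements of `U_{≤0}`. -/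
def bleq (n : I → ℕ) (k : B.ix n) : Uleq D := ⟨B.b n k, Uminus_le D n (B.b n k).2⟩

/-- The dual basis vectors of `U⁺`, as elements of `U_{≥0}`. -/
def bsgeq (n : I → ℕ) (k : B.ix n) : Ugeq D := ⟨B.bs n k, Uplus_le D n (B.bs n k).2⟩

theorem theta_eq (n : I → ℕ) :
    B.theta n = ∑ k, (B.bleq n k : U D) ⊗ₜ[Qvt] (B.bsgeq n k : U D) := rfl

variable {n m : I → ℕ} (i : I)

theorem bleq_mem (k : B.ix n) : B.bleq n k ∈ wordSpan Qvt (Fleq D) (toZ n) := by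
  rw [← coe_mem_wordSpan_F, ← Uminus_eq_wordSpan]
  exact (B.b n k).2

theorem bsgeq_mem (k : B.ix n) : B.bsgeq n k ∈ wordSpan Qvt (Egeq D) (toZ n) := by
  rw [← coe_mem_wordSpan_E, ← Uplus_eq_wordSpan]
  exact (B.bs n k).2

open Classical in
theorem pairing_bsgeq_bleq (k l : B.ix n) :
    pairing D (B.bsgeq n k) (B.bleq n l) = if k = l then 1 else 0 := B.dual n k l

theorem sum_pairing_bleq {x : Ugeq D} (hx : x ∈ wordSpan Qvt (Egeq D) (toZ n)) :
    ∑ k, pairing D x (B.bleq n k) • B.bsgeq n k = x := by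
  classical
  rw [← coe_mem_wordSpan_E, ← Uplus_eq_wordSpan] at hx
  obtain ⟨a, rfl⟩ : ∃ a : B.ix n → Qvt, x = ∑ k, a k • B.bsgeq n k :=
    ⟨(B.bs n).repr ⟨x, hx⟩, Subtype.ext <| by
      have sum_repr := congrArg Subtype.val ((B.bs n).sum_repr ⟨x, hx⟩)
      simp only [Submodule.coe_sum, SetLike.val_smul] at sum_repr
      simpa [bsgeq] using sum_repr.symm⟩
  simp [pairing_bsgeq_bleq]

theorem sum_pairing_bsgeq {y : Uleq D} (hy : y ∈ wordSpan Qvt (Fleq D) (toZ n)) :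
    ∑ k, pairing D (B.bsgeq n k) y • B.bleq n k = y := by
  classical
  rw [← coe_mem_wordSpan_F, ← Uminus_eq_wordSpan] at hy
  obtain ⟨a, rfl⟩ : ∃ a : B.ix n → Qvt, y = ∑ k, a k • B.bleq n k :=
    ⟨(B.b n).repr ⟨y, hy⟩, Subtype.ext <| by
      have sum_repr := congrArg Subtype.val ((B.b n).sum_repr ⟨y, hy⟩)
      simp only [Submodule.coe_sum, SetLike.val_smul] at sum_repr
      simpa [bleq] using sum_repr.symm⟩
  simp [pairing_bsgeq_bleq]

theorem sum_pairing_bsgeq_mul_K'leq {y : Uleq D} (hy : y ∈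
      (wordSpan Qvt (Fleq D) (toZ n)).map (LinearMap.mulRight Qvt (K'leq D (sg i)))) :
    ∑ k, pairing D (B.bsgeq n k) y • (B.bleq n k * K'leq D (sg i)) = y := by
  obtain ⟨y, hy, rfl⟩ := hy
  simp only [LinearMap.mulRight_apply, B.isSkewHopfPairing.apply_mul_K'leq i (B.bsgeq_mem _) hy,
    ← smul_mul_assoc, ← Finset.sum_mul, B.sum_pairing_bsgeq hy]

theorem sum_pairing_bleq_mul_Kgeq {x : Ugeq D} (hx : x ∈
      (wordSpan Qvt (Egeq D) (toZ n)).map (LinearMap.mulRight Qvt (Kgeq D (sg i)))) :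
    ∑ k, pairing D x (B.bleq n k) • (B.bsgeq n k * Kgeq D (sg i)) = x := by
  obtain ⟨x, hx, rfl⟩ := hx
  simp only [LinearMap.mulRight_apply, B.isSkewHopfPairing.mul_Kgeq_apply i hx (B.bleq_mem _),
    ← smul_mul_assoc, ← Finset.sum_mul, B.sum_pairing_bleq hx]

section

variable (hnm : toZ n = sg i + toZ m)
include hnm

theorem sum_adjMulRightE_tmul :
    ∑ k, (adjMulRightE (pairing D) i (B.bleq n k) : U D) ⊗ₜ[Qvt] (B.bsgeq n k : U D) =
      B.theta m * (U.K' D i ⊗ₜ U.E D i) := by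
  simp only [theta_eq, Finset.sum_mul, Algebra.TensorProduct.tmul_mul_tmul]
  have h := B.isSkewHopfPairing
  refine sum_tmul_eq_sum_tmul
    (a := fun l k => pairing D (B.bsgeq m l * Egeq D i) (B.bleq n k)) (fun k => ?_) fun l => ?_
  · have mem := h.adjMulRightE_mem i (B.bleq_mem k)
    rw [hnm, add_sub_cancel_left] at mem
    simpa [h.apply_adjMulRightE, coe_K'leq_sg] using
      congrArg Subtype.val (B.sum_pairing_bsgeq_mul_K'leq i mem).symm
  · have mem := mul_letter_mem_wordSpan i (B.bsgeq_mem l)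
    rw [← hnm] at mem
    simpa [Egeq] using congrArg Subtype.val (B.sum_pairing_bleq mem).symm

theorem sum_adjMulLeftE_tmul :
    ∑ k, (adjMulLeftE (pairing D) i (B.bleq n k) : U D) ⊗ₜ[Qvt] (B.bsgeq n k : U D) =
      (1 ⊗ₜ U.E D i) * B.theta m := by
  simp only [theta_eq, Finset.mul_sum, Algebra.TensorProduct.tmul_mul_tmul, one_mul]
  have h := B.isSkewHopfPairing
  refine sum_tmul_eq_sum_tmul
    (a := fun l k => pairing D (Egeq D i * B.bsgeq m l) (B.bleq n k)) (fun k => ?_) fun l => ?_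
  · have mem := (h.isLeftSkewDer_adjMulLeftE i).apply_mem (B.bleq_mem k)
    rw [hnm, add_sub_cancel_left] at mem
    simpa [h.apply_adjMulLeftE] using congrArg Subtype.val (B.sum_pairing_bsgeq mem).symm
  · have mem := letter_mul_mem_wordSpan i (B.bsgeq_mem l)
    rw [← hnm] at mem
    simpa [Egeq] using congrArg Subtype.val (B.sum_pairing_bleq mem).symm

theorem sum_tmul_adjMulRightF :
    ∑ k, (B.bleq n k : U D) ⊗ₜ[Qvt] (adjMulRightF (pairing D) i (B.bsgeq n k) : U D) =
      B.theta m * (U.F D i ⊗ₜ U.K D i) := by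
  simp only [theta_eq, Finset.sum_mul, Algebra.TensorProduct.tmul_mul_tmul]
  have h := B.isSkewHopfPairing
  refine (sum_tmul_eq_sum_tmul
    (a := fun k l => pairing D (B.bsgeq n k) (B.bleq m l * Fleq D i)) (fun l => ?_)
    fun k => ?_).symm
  · have mem := mul_letter_mem_wordSpan i (B.bleq_mem l)
    rw [← hnm] at mem
    simpa [Fleq] using congrArg Subtype.val (B.sum_pairing_bsgeq mem).symm
  · have mem := h.adjMulRightF_mem i (B.bsgeq_mem k)
    rw [hnm, add_sub_cancel_left] at mem
    simpa [h.adjMulRightF_apply, coe_Kgeq_sg] using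
      congrArg Subtype.val (B.sum_pairing_bleq_mul_Kgeq i mem).symm

theorem sum_tmul_adjMulLeftF :
    ∑ k, (B.bleq n k : U D) ⊗ₜ[Qvt] (adjMulLeftF (pairing D) i (B.bsgeq n k) : U D) =
      (U.F D i ⊗ₜ 1) * B.theta m := by
  simp only [theta_eq, Finset.mul_sum, Algebra.TensorProduct.tmul_mul_tmul, one_mul]
  have h := B.isSkewHopfPairing
  refine (sum_tmul_eq_sum_tmul
    (a := fun k l => pairing D (B.bsgeq n k) (Fleq D i * B.bleq m l)) (fun l => ?_)
    fun k => ?_).symm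
  · have mem := letter_mul_mem_wordSpan i (B.bleq_mem l)
    rw [← hnm] at mem
    simpa [Fleq] using congrArg Subtype.val (B.sum_pairing_bsgeq mem).symm
  · have mem := (h.isLeftSkewDer_adjMulLeftF i).apply_mem (B.bsgeq_mem k)
    rw [hnm, add_sub_cancel_left] at mem
    simpa [h.adjMulLeftF_apply] using congrArg Subtype.val (B.sum_pairing_bleq mem).symm

end

theorem theta_commutator_E : (U.E D i ⊗ₜ 1) * B.theta n - B.theta n * (U.E D i ⊗ₜ 1) =
    ∑ k, (adjMulRightE (pairing D) i (B.bleq n k) : U D) ⊗ₜ[Qvt] (B.bsgeq n k : U D) -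
      (U.K D i ⊗ₜ 1) *
        ∑ k, (adjMulLeftE (pairing D) i (B.bleq n k) : U D) ⊗ₜ[Qvt] (B.bsgeq n k : U D) := by
  simp only [theta_eq, Finset.mul_sum, Finset.sum_mul, ← Finset.sum_sub_distrib,
    Algebra.TensorProduct.tmul_mul_tmul, one_mul, mul_one, ← TensorProduct.sub_tmul,
    B.isSkewHopfPairing.E_commutator i (B.bleq_mem _)]

theorem theta_commutator_F : (1 ⊗ₜ U.F D i) * B.theta n - B.theta n * (1 ⊗ₜ U.F D i) =
    ∑ k, (B.bleq n k : U D) ⊗ₜ[Qvt] (adjMulRightF (pairing D) i (B.bsgeq n k) : U D) -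
      (1 ⊗ₜ U.K' D i) *
        ∑ k, (B.bleq n k : U D) ⊗ₜ[Qvt] (adjMulLeftF (pairing D) i (B.bsgeq n k) : U D) := by
  simp only [theta_eq, Finset.mul_sum, Finset.sum_mul, ← Finset.sum_sub_distrib,
    Algebra.TensorProduct.tmul_mul_tmul, one_mul, mul_one, ← TensorProduct.tmul_sub,
    B.isSkewHopfPairing.F_commutator i (B.bsgeq_mem _)]

/-- `Θ_d` for `d ∈ ℤ[I]`, with `Θ_d = 0` for `d ∉ ℕ[I]`, so that `Θ_{d - i}` makes sense. -/
def thetaZ : (I → ℤ) → U D ⊗[Qvt] U D := Function.extend toZ B.theta 0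

variable (n) in
theorem thetaZ_toZ : B.thetaZ (toZ n) = B.theta n := toZ_injective.extend_apply _ _ n

theorem thetaZ_eq_zero {d : I → ℤ} (hd : ∀ n : I → ℕ, toZ n ≠ d) : B.thetaZ d = 0 :=
  Function.extend_apply' _ _ _ (not_exists.2 hd)

theorem thetaZ_mul_E (d : I → ℤ) :
    B.thetaZ d * (U.E D i ⊗ₜ 1) + B.thetaZ (d - sg i) * (U.K' D i ⊗ₜ U.E D i) =
      (U.E D i ⊗ₜ 1) * B.thetaZ d + (U.K D i ⊗ₜ U.E D i) * B.thetaZ (d - sg i) := by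
  by_cases hd : ∃ n, toZ n = d
  · obtain ⟨n, rfl⟩ := hd
    have hcomm := B.theta_commutator_E (n := n) i
    by_cases hm : ∃ m, toZ m = toZ n - sg i
    · obtain ⟨m, hm⟩ := hm
      have hnm : toZ n = sg i + toZ m := by rw [hm, add_sub_cancel]
      rw [B.sum_adjMulRightE_tmul i hnm, B.sum_adjMulLeftE_tmul i hnm, ← mul_assoc,
        Algebra.TensorProduct.tmul_mul_tmul, one_mul, mul_one, sub_eq_sub_iff_add_eq_add] at hcomm
      rw [← hm, thetaZ_toZ, thetaZ_toZ, hcomm, add_comm]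
    · have hR k := B.isSkewHopfPairing.adjMulRightE_mem i (B.bleq_mem (n := n) k)
      have hL k := (B.isSkewHopfPairing.isLeftSkewDer_adjMulLeftE i).apply_mem
        (B.bleq_mem (n := n) k)
      simp only [wordSpan_eq_bot (not_exists.1 hm), Submodule.map_bot, Submodule.mem_bot] at hR hL
      simp only [hR, hL, ZeroMemClass.coe_zero, TensorProduct.zero_tmul, Finset.sum_const_zero,
        mul_zero, sub_zero, sub_eq_zero] at hcomm
      rw [thetaZ_toZ, B.thetaZ_eq_zero (not_exists.1 hm), hcomm, zero_mul, mul_zero]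
  · rw [not_exists] at hd
    simp [B.thetaZ_eq_zero hd, B.thetaZ_eq_zero (toZ_ne_sub_sg hd i)]

theorem thetaZ_mul_F (d : I → ℤ) :
    B.thetaZ d * (1 ⊗ₜ U.F D i) + B.thetaZ (d - sg i) * (U.F D i ⊗ₜ U.K D i) =
      (1 ⊗ₜ U.F D i) * B.thetaZ d + (U.F D i ⊗ₜ U.K' D i) * B.thetaZ (d - sg i) := by
  by_cases hd : ∃ n, toZ n = d
  · obtain ⟨n, rfl⟩ := hd
    have hcomm := B.theta_commutator_F (n := n) i
    by_cases hm : ∃ m, toZ m = toZ n - sg i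
    · obtain ⟨m, hm⟩ := hm
      have hnm : toZ n = sg i + toZ m := by rw [hm, add_sub_cancel]
      rw [B.sum_tmul_adjMulRightF i hnm, B.sum_tmul_adjMulLeftF i hnm, ← mul_assoc,
        Algebra.TensorProduct.tmul_mul_tmul, one_mul, mul_one, sub_eq_sub_iff_add_eq_add] at hcomm
      rw [← hm, thetaZ_toZ, thetaZ_toZ, hcomm, add_comm]
    · have hR k := B.isSkewHopfPairing.adjMulRightF_mem i (B.bsgeq_mem (n := n) k)
      have hL k := (B.isSkewHopfPairing.isLeftSkewDer_adjMulLeftF i).apply_mem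
        (B.bsgeq_mem (n := n) k)
      simp only [wordSpan_eq_bot (not_exists.1 hm), Submodule.map_bot, Submodule.mem_bot] at hR hL
      simp only [hR, hL, ZeroMemClass.coe_zero, TensorProduct.tmul_zero, Finset.sum_const_zero,
        mul_zero, sub_zero, sub_eq_zero] at hcomm
      rw [thetaZ_toZ, B.thetaZ_eq_zero (not_exists.1 hm), hcomm, zero_mul, mul_zero]
  · rw [not_exists] at hd
    simp [B.thetaZ_eq_zero hd, B.thetaZ_eq_zero (toZ_ne_sub_sg hd i)]

variable (n) in
theorem theta_mul_K : B.theta n * (U.K D i ⊗ₜ U.K D i) = (U.K D i ⊗ₜ U.K D i) * B.theta n := by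
  rw [theta_eq, Finset.mul_sum, Finset.sum_mul]
  refine Finset.sum_congr rfl fun k _ => ?_
  rw [Algebra.TensorProduct.tmul_mul_tmul, Algebra.TensorProduct.tmul_mul_tmul,
    K_mul_of_mem_F i (coe_mem_wordSpan_F.2 (B.bleq_mem k)),
    K_mul_of_mem_E i (coe_mem_wordSpan_E.2 (B.bsgeq_mem k)),
    TensorProduct.smul_tmul_smul, inv_mul_cancel₀ (D.brace_ne_zero _ _), one_smul]

variable (n) in
theorem theta_mul_K' :
    B.theta n * (U.K' D i ⊗ₜ U.K' D i) = (U.K' D i ⊗ₜ U.K' D i) * B.theta n := by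
  rw [theta_eq, Finset.mul_sum, Finset.sum_mul]
  refine Finset.sum_congr rfl fun k _ => ?_
  rw [Algebra.TensorProduct.tmul_mul_tmul, Algebra.TensorProduct.tmul_mul_tmul,
    K'_mul_of_mem_F i (coe_mem_wordSpan_F.2 (B.bleq_mem k)),
    K'_mul_of_mem_E i (coe_mem_wordSpan_E.2 (B.bsgeq_mem k)),
    TensorProduct.smul_tmul_smul, mul_inv_cancel₀ (D.brace_ne_zero _ _), one_smul]

theorem theta_zero : B.theta 0 = 1 := by
  choose a ha using fun k =>
    exists_eq_algebraMap_of_mem_wordSpan_zero (B.bsgeq_mem (n := 0) k)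
  have expansion_one := congrArg Subtype.val (B.sum_pairing_bsgeq (n := 0) one_mem_wordSpan)
  have coe_bsgeq k : (B.bsgeq 0 k : U D) = pairing D (B.bsgeq 0 k) 1 • 1 := by
    rw [ha, Algebra.algebraMap_eq_smul_one, map_smul, LinearMap.smul_apply,
      B.isSkewHopfPairing.one_left]
    simp
  simp only [theta_eq, coe_bsgeq]
  simp only [TensorProduct.tmul_smul, TensorProduct.smul_tmul', ← TensorProduct.sum_tmul]
  rw [Algebra.TensorProduct.one_def]
  congr 1
  simpa using expansion_one

end DualBases

end CanonicalElement

section WeightModules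

theorem exists_tmul_eq_smul_of_isInternal {R M N ι κ : Type*} [CommSemiring R] [DecidableEq ι]
    [DecidableEq κ] [AddCommMonoid M] [AddCommMonoid N] [Module R M] [Module R N]
    {A : ι → Submodule R M} {B : κ → Submodule R N} (hA : DirectSum.IsInternal A)
    (hB : DirectSum.IsInternal B) (c : ι → κ → R) : ∃ f : M ⊗[R] N →ₗ[R] M ⊗[R] N,
      ∀ i j, ∀ x ∈ A i, ∀ y ∈ B j, f (x ⊗ₜ y) = c i j • x ⊗ₜ y := by
  let eA := LinearEquiv.ofBijective (DirectSum.coeLinearMap A) hA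
  let eB := LinearEquiv.ofBijective (DirectSum.coeLinearMap B) hB
  let e := (TensorProduct.congr eA eB).symm.trans
    (TensorProduct.directSum R R (fun i => A i) fun j => B j)
  refine ⟨e.symm.toLinearMap ∘ₗ
    DirectSum.lmap (fun p : ι × κ => c p.1 p.2 • LinearMap.id) ∘ₗ e.toLinearMap,
    fun i j x hx y hy => ?_⟩
  have he : e (x ⊗ₜ y) = DirectSum.lof R (ι × κ) (fun p => A p.1 ⊗[R] B p.2) (i, j)
      (⟨x, hx⟩ ⊗ₜ ⟨y, hy⟩) := by
    have hx' : eA.symm x = DirectSum.lof R ι (fun i => A i) i ⟨x, hx⟩ :=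
      (LinearEquiv.symm_apply_eq _).2 (DirectSum.coeLinearMap_lof A i ⟨x, hx⟩).symm
    have hy' : eB.symm y = DirectSum.lof R κ (fun j => B j) j ⟨y, hy⟩ :=
      (LinearEquiv.symm_apply_eq _).2 (DirectSum.coeLinearMap_lof B j ⟨y, hy⟩).symm
    simp only [e, LinearEquiv.trans_apply, TensorProduct.congr_symm_tmul, hx', hy',
      TensorProduct.directSum_lof_tmul_lof]
  simp only [LinearMap.comp_apply, LinearEquiv.coe_coe, he, DirectSum.lmap_lof,
    LinearMap.smul_apply, LinearMap.id_apply, map_smul]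
  rw [← he, LinearEquiv.symm_apply_apply]

theorem pow_eq_zero_of_le_comap {R V : Type*} [Semiring R] [AddCommMonoid V] [Module R V]
    {f : Module.End R V} {F : ℤ → Submodule R V} (hF : ∀ a, F (a + 1) ≤ (F a).comap f) {a : ℤ}
    {k : ℕ} (bot : F a = ⊥) (top : F (a + k) = ⊤) : f ^ k = 0 := by
  have pow_mem : ∀ k : ℕ, ∀ z ∈ F (a + k), (f ^ k) z ∈ F a := fun k => by
    induction k with
    | zero => simp
    | succ k ih =>
      intro z hz
      rw [Nat.cast_succ, ← add_assoc] at hz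
      exact ih (f z) (hF _ hz)
  ext z
  simpa [bot] using pow_mem k z (by simp [top])

variable {I : Type*} [Fintype I] [DecidableEq I] {D : Datum I}
  {M N : Type*} [AddCommGroup M] [Module Qvt M] [Module (U D) M] [IsScalarTower Qvt (U D) M]
  [AddCommGroup N] [Module Qvt N] [Module (U D) N] [IsScalarTower Qvt (U D) N]

theorem tensorEnd_tmul (a b : U D) (x : M) (y : N) :
    tensorEnd D M N (a ⊗ₜ b) (x ⊗ₜ y) = (a • x) ⊗ₜ (b • y) := rfl

section

variable {l d : I → ℤ} {a : U D} {x : M}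

theorem mem_weightSpace : x ∈ weightSpace D M l ↔ ∀ i,
    U.K D i • x = D.brace (sg i) l • x ∧ U.K' D i • x = (D.brace l (sg i))⁻¹ • x := by
  simp only [Datum.inv_brace, show ∀ i, D.dot l (sg i) = D.dot (sg i) l from fun _ => add_comm _ _]
  exact Iff.rfl

theorem smul_mem_weightSpace_of_mem_E (ha : a ∈ wordSpan Qvt (U.E D) d)
    (hx : x ∈ weightSpace D M l) : a • x ∈ weightSpace D M (l + d) := by
  rw [mem_weightSpace] at hx ⊢
  intro i
  rw [← mul_smul, ← mul_smul, K_mul_of_mem_E i ha, K'_mul_of_mem_E i ha, smul_assoc, smul_assoc,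
    mul_smul, mul_smul, (hx i).1, (hx i).2, smul_comm a, smul_comm a, smul_smul, smul_smul,
    D.brace_add_right, D.brace_add_left, mul_inv, mul_comm (D.brace (sg i) l),
    mul_comm (D.brace l (sg i))⁻¹]
  exact ⟨rfl, rfl⟩

theorem smul_mem_weightSpace_of_mem_F (ha : a ∈ wordSpan Qvt (U.F D) d)
    (hx : x ∈ weightSpace D M l) : a • x ∈ weightSpace D M (l - d) := by
  obtain ⟨m, rfl⟩ : ∃ m, l = m + d := ⟨l - d, by simp⟩
  rw [add_sub_cancel_right]
  rw [mem_weightSpace] at hx ⊢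
  intro i
  rw [← mul_smul, ← mul_smul, K_mul_of_mem_F i ha, K'_mul_of_mem_F i ha, smul_assoc, smul_assoc,
    mul_smul, mul_smul, (hx i).1, (hx i).2, smul_comm a, smul_comm a, smul_smul, smul_smul,
    D.brace_add_right, D.brace_add_left, mul_comm (D.brace m (sg i)), mul_inv,
    mul_comm (D.brace (sg i) m), inv_mul_cancel_left₀ (D.brace_ne_zero _ _),
    mul_inv_cancel_left₀ (D.brace_ne_zero _ _)]
  exact ⟨rfl, rfl⟩

end

section

variable {P : Type*} [AddCommGroup P] [Module Qvt P] {f g : M ⊗[Qvt] N →ₗ[Qvt] P}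

omit [Module (U D) N] [IsScalarTower Qvt (U D) N] in
theorem IsWeightModule.ext_tmul_left (hM : IsWeightModule D M)
    (h : ∀ l, ∀ x ∈ weightSpace D M l, ∀ y, f (x ⊗ₜ y) = g (x ⊗ₜ y)) : f = g := by
  refine TensorProduct.ext' fun x => ?_
  refine Submodule.iSup_induction (weightSpace D M) (x := x)
    (motive := fun x => ∀ y, f (x ⊗ₜ y) = g (x ⊗ₜ y))
    (DirectSum.IsInternal.submodule_iSup_eq_top hM ▸ Submodule.mem_top) h (by simp)
    fun x x' hx hx' y => ?_
  simp only [TensorProduct.add_tmul, map_add, hx, hx']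

theorem IsWeightModule.ext_tmul (hM : IsWeightModule D M) (hN : IsWeightModule D N)
    (h : ∀ l m, ∀ x ∈ weightSpace D M l, ∀ y ∈ weightSpace D N m, f (x ⊗ₜ y) = g (x ⊗ₜ y)) :
    f = g := by
  refine hM.ext_tmul_left fun l x hx y => ?_
  refine Submodule.iSup_induction (weightSpace D N) (x := y)
    (motive := fun y => f (x ⊗ₜ y) = g (x ⊗ₜ y))
    (DirectSum.IsInternal.submodule_iSup_eq_top hN ▸ Submodule.mem_top)
    (fun m => h l m x hx) (by simp) fun y y' hy hy' => ?_
  simp only [TensorProduct.tmul_add, map_add, hy, hy']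

end

theorem IsWeightModule.decomp_of_mem (hM : IsWeightModule D M) {l : I → ℤ} {x : M}
    (hx : x ∈ weightSpace D M l) :
    hM.decomp x = DirectSum.lof Qvt (I → ℤ) (fun l => weightSpace D M l) l ⟨x, hx⟩ :=
  (LinearEquiv.symm_apply_eq _).2 (DirectSum.coeLinearMap_lof (weightSpace D M) l ⟨x, hx⟩).symm

theorem IsWeightModule.finite_weights [FiniteDimensional Qvt M] (hM : IsWeightModule D M) :
    {l | weightSpace D M l ≠ ⊥}.Finite :=
  WellFoundedGT.finite_ne_bot_of_iSupIndep hM.submodule_iSupIndep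

theorem ftilde_tmul (hM : IsWeightModule D M) (hN : IsWeightModule D N) {l m : I → ℤ} {x : M}
    {y : N} (hx : x ∈ weightSpace D M l) (hy : y ∈ weightSpace D N m) :
    ftilde hM hN (x ⊗ₜ y) = fmap D l m • x ⊗ₜ[Qvt] y := by
  simp [ftilde, ftildeAux, hM.decomp_of_mem hx, hN.decomp_of_mem hy]

section Height

omit [Module (U D) N] [IsScalarTower Qvt (U D) N]

variable (D M N) in
/-- The span of the tensors `x ⊗ y` with `x` a weight vector whose weight has coordinate sum less
than `a`: an increasing filtration of `M ⊗ N` which every `Θ_ν` with `ν ≠ 0` lowers. -/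
def heightLT (a : ℤ) : Submodule Qvt (M ⊗[Qvt] N) :=
  Submodule.span Qvt {z | ∃ l, ∑ i, l i < a ∧ ∃ x ∈ weightSpace D M l, ∃ y : N, x ⊗ₜ y = z}

theorem tmul_mem_heightLT {a : ℤ} {l : I → ℤ} (hl : ∑ i, l i < a) {x : M}
    (hx : x ∈ weightSpace D M l) (y : N) : x ⊗ₜ y ∈ heightLT D M N a :=
  Submodule.subset_span ⟨l, hl, x, hx, y, rfl⟩

theorem heightLT_eq_bot {a : ℤ} (ha : ∀ l, weightSpace D M l ≠ ⊥ → a ≤ ∑ i, l i) :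
    heightLT D M N a = ⊥ := by
  refine Submodule.span_eq_bot.2 ?_
  rintro _ ⟨l, hl, x, hx, y, rfl⟩
  have eq_bot : weightSpace D M l = ⊥ := by_contra fun h => (ha l h).not_gt hl
  rw [eq_bot, Submodule.mem_bot] at hx
  rw [hx, TensorProduct.zero_tmul]

theorem heightLT_eq_top (hM : IsWeightModule D M) {a : ℤ}
    (ha : ∀ l, weightSpace D M l ≠ ⊥ → ∑ i, l i < a) : heightLT D M N a = ⊤ := by
  rw [← Submodule.ker_mkQ (heightLT D M N a), LinearMap.ker_eq_top]
  refine hM.ext_tmul_left fun l x hx y => ?_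
  rw [LinearMap.zero_apply, Submodule.mkQ_apply, Submodule.Quotient.mk_eq_zero]
  by_cases hl : weightSpace D M l = ⊥
  · rw [hl, Submodule.mem_bot] at hx
    simp [hx]
  · exact tmul_mem_heightLT (ha l hl) hx y

theorem isNilpotent_of_le_comap_heightLT (hM : IsWeightModule D M)
    (hfin : {l | weightSpace D M l ≠ ⊥}.Finite) {f : Module.End Qvt (M ⊗[Qvt] N)}
    (hf : ∀ a, heightLT D M N (a + 1) ≤ (heightLT D M N a).comap f) : IsNilpotent f := by
  obtain ⟨a, ha⟩ := (hfin.image fun l => ∑ i, l i).bddBelow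
  obtain ⟨b, hb⟩ := (hfin.image fun l => ∑ i, l i).bddAbove
  refine ⟨(b + 1 - a).toNat, pow_eq_zero_of_le_comap hf (a := a)
    (heightLT_eq_bot fun l hl => ha ⟨l, hl, rfl⟩)
    (heightLT_eq_top hM fun l hl => ?_)⟩
  have := hb ⟨l, hl, rfl⟩
  dsimp only at this
  omega

end Height

namespace DualBases

variable (B : DualBases D)

include B in
theorem fmap_eq (l m : I → ℤ) : fmap D l m = (D.brace l m)⁻¹ := by
  rw [fmap, B.isSkewHopfPairing.apply_Kgeq_K'leq]

include B in
theorem bijective_ftilde (hM : IsWeightModule D M) (hN : IsWeightModule D N) :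
    Function.Bijective (ftilde hM hN) := by
  obtain ⟨g, hg⟩ := exists_tmul_eq_smul_of_isInternal hM hN D.brace
  have left_inv : g ∘ₗ ftilde hM hN = LinearMap.id := hM.ext_tmul hN fun l m x hx y hy => by
    rw [LinearMap.comp_apply, ftilde_tmul hM hN hx hy, map_smul, hg l m x hx y hy, B.fmap_eq,
      inv_smul_smul₀ (D.brace_ne_zero _ _), LinearMap.id_apply]
  have right_inv : ftilde hM hN ∘ₗ g = LinearMap.id := hM.ext_tmul hN fun l m x hx y hy => by
    rw [LinearMap.comp_apply, hg l m x hx y hy, map_smul, ftilde_tmul hM hN hx hy, B.fmap_eq,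
      smul_inv_smul₀ (D.brace_ne_zero _ _), LinearMap.id_apply]
  exact Function.bijective_iff_has_inverse.2
    ⟨g, LinearMap.congr_fun left_inv, LinearMap.congr_fun right_inv⟩

theorem tensorEnd_theta_tmul (n : I → ℕ) (x : M) (y : N) : tensorEnd D M N (B.theta n) (x ⊗ₜ y) =
    ∑ k, ((B.bleq n k : U D) • x) ⊗ₜ[Qvt] ((B.bsgeq n k : U D) • y) := by
  rw [theta_eq, map_sum, LinearMap.sum_apply]
  rfl

theorem bleq_smul_mem {n : I → ℕ} (k : B.ix n) {l : I → ℤ} {x : M}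
    (hx : x ∈ weightSpace D M l) : (B.bleq n k : U D) • x ∈ weightSpace D M (l - toZ n) :=
  smul_mem_weightSpace_of_mem_F (coe_mem_wordSpan_F.2 (B.bleq_mem k)) hx

theorem heightLT_le_comap_theta {n : I → ℕ} (hn : n ≠ 0) (a : ℤ) :
    heightLT D M N (a + 1) ≤ (heightLT D M N a).comap (tensorEnd D M N (B.theta n)) := by
  refine Submodule.span_le.2 ?_
  rintro _ ⟨l, hl, x, hx, y, rfl⟩
  obtain ⟨i, hi⟩ := Function.ne_iff.1 hn
  have sum_pos : 0 < ∑ i, n i := (Nat.pos_of_ne_zero hi).trans_le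
    (Finset.single_le_sum (fun _ _ => Nat.zero_le _) (Finset.mem_univ i))
  have sum_lt : ∑ i, (l - toZ n) i < a := by
    have : ∑ i, (l - toZ n) i = ∑ i, l i - (∑ i, n i : ℕ) := by simp [toZ]
    omega
  rw [Submodule.comap_coe, Set.mem_preimage, B.tensorEnd_theta_tmul]
  exact sum_mem fun k _ => tmul_mem_heightLT sum_lt (B.bleq_smul_mem k hx) _

section

variable (hM : IsWeightModule D M) (hfin : {l | weightSpace D M l ≠ ⊥}.Finite)
include hM hfin

theorem finite_theta : {n : I → ℕ | tensorEnd D M N (B.theta n) ≠ 0}.Finite := by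
  refine ((hfin.image2 (· - ·) hfin).preimage toZ_injective.injOn).subset fun n hn => ?_
  by_contra hdiff
  refine hn (hM.ext_tmul_left fun l x hx y => ?_)
  rw [B.tensorEnd_theta_tmul, LinearMap.zero_apply]
  refine Finset.sum_eq_zero fun k _ => ?_
  suffices (B.bleq n k : U D) • x = 0 by rw [this, TensorProduct.zero_tmul]
  by_contra hbx
  have ne_bot {m : I → ℤ} {z : M} (hz : z ∈ weightSpace D M m) (hz0 : z ≠ 0) :
      weightSpace D M m ≠ ⊥ := Submodule.ne_bot_iff _ |>.2 ⟨z, hz, hz0⟩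
  exact hdiff ⟨l, ne_bot hx fun hx0 => hbx (by rw [hx0, smul_zero]), l - toZ n,
    ne_bot (B.bleq_smul_mem k hx) hbx, sub_sub_cancel _ _⟩

theorem isUnit_thetaOp : IsUnit (B.thetaOp M N) := by
  classical
  let S := (B.finite_theta (N := N) hM hfin).toFinset
  have thetaOp_eq : B.thetaOp M N = 1 + ∑ n ∈ S.erase 0, tensorEnd D M N (B.theta n) := by
    rw [thetaOp, finsum_eq_sum_of_support_subset (s := insert 0 S), ← Finset.insert_erase
      (Finset.mem_insert_self 0 S), Finset.sum_insert (Finset.notMem_erase _ _), theta_zero,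
      map_one, Finset.erase_insert_eq_erase]
    exact fun n hn => by simpa [S] using Or.inr hn
  rw [thetaOp_eq]
  refine (isNilpotent_of_le_comap_heightLT hM hfin fun a z hz => ?_).isUnit_one_add
  rw [Submodule.mem_comap, LinearMap.sum_apply]
  exact sum_mem fun n hn => B.heightLT_le_comap_theta (Finset.ne_of_mem_erase hn) a hz

theorem thetaOp_commute {a : U D ⊗[Qvt] U D} (h : ∀ n, B.theta n * a = a * B.theta n) :
    B.thetaOp M N * tensorEnd D M N a = tensorEnd D M N a * B.thetaOp M N := by
  have hf := B.finite_theta (N := N) hM hfin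
  rw [thetaOp, finsum_mul' _ _ hf, mul_finsum' _ _ hf]
  exact finsum_congr fun n => by rw [← map_mul, ← map_mul, h]

theorem finite_thetaZ : (Function.support fun d => tensorEnd D M N (B.thetaZ d)).Finite := by
  refine ((B.finite_theta (N := N) hM hfin).image toZ).subset fun d hd => ?_
  rw [Function.mem_support] at hd
  by_cases h : ∃ n, toZ n = d
  · obtain ⟨n, rfl⟩ := h
    exact ⟨n, by rwa [thetaZ_toZ] at hd, rfl⟩
  · rw [B.thetaZ_eq_zero (not_exists.1 h), map_zero] at hd
    exact (hd rfl).elim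

end

variable (M N) in
theorem thetaOp_eq_finsum : B.thetaOp M N = ∑ᶠ d, tensorEnd D M N (B.thetaZ d) := by
  have support_subset : (Function.support fun d => tensorEnd D M N (B.thetaZ d)) ⊆
      Set.range toZ := fun d hd => by
    by_contra hn
    refine hd ?_
    dsimp only
    rw [B.thetaZ_eq_zero fun n h => hn ⟨n, h⟩, map_zero]
  rw [← Set.indicator_eq_self.2 support_subset, ← finsum_mem_def, finsum_mem_range toZ_injective]
  simp only [thetaZ_toZ, thetaOp]

theorem thetaOp_relation (hM : IsWeightModule D M) (hfin : {l | weightSpace D M l ≠ ⊥}.Finite)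
    (i : I) {a b a' b' : U D ⊗[Qvt] U D}
    (h : ∀ d, B.thetaZ d * a + B.thetaZ (d - sg i) * b =
      a' * B.thetaZ d + b' * B.thetaZ (d - sg i)) :
    B.thetaOp M N * tensorEnd D M N (a + b) = tensorEnd D M N (a' + b') * B.thetaOp M N := by
  have hf := B.finite_thetaZ (N := N) hM hfin
  have hf' : (Function.support fun d => tensorEnd D M N (B.thetaZ (d - sg i))).Finite :=
    hf.preimage (f := fun d => d - sg i) sub_left_injective.injOn
  have thetaOp_eq_shift : B.thetaOp M N = ∑ᶠ d, tensorEnd D M N (B.thetaZ (d - sg i)) := by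
    rw [thetaOp_eq_finsum]
    exact (finsum_comp_equiv (Equiv.subRight (sg i))).symm
  rw [map_add, map_add, mul_add, add_mul]
  nth_rewrite 2 [thetaOp_eq_shift]
  nth_rewrite 3 [thetaOp_eq_shift]
  rw [thetaOp_eq_finsum, finsum_mul' _ _ hf, finsum_mul' _ _ hf', mul_finsum' _ _ hf,
    mul_finsum' _ _ hf',
    ← finsum_add_distrib (hf.subset (Function.support_mul_subset_left _ _))
      (hf'.subset (Function.support_mul_subset_left _ _)),
    ← finsum_add_distrib (hf.subset (Function.support_mul_subset_right _ _))
      (hf'.subset (Function.support_mul_subset_right _ _))]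
  exact finsum_congr fun d => by simp only [← map_mul, ← map_add, h]

end DualBases

end WeightModules

section Intertwining

section

variable {R A V W : Type*} [CommSemiring R] [Semiring A] [Algebra R A] [AddCommMonoid V]
  [Module R V] [AddCommMonoid W] [Module R W]

/-- The elements of `A` whose actions `ρ` on `V` and `σ` on `W` are intertwined by `f`. They form a
subalgebra, so that the intertwining property need only be checked on generators. -/
def intertwined (ρ : A →ₐ[R] Module.End R V) (σ : A →ₐ[R] Module.End R W) (f : V →ₗ[R] W) :
    Subalgebra R A where
  carrier := {u | ∀ z, f (ρ u z) = σ u (f z)}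
  mul_mem' ha hb z := by
    rw [map_mul, map_mul, Module.End.mul_apply, Module.End.mul_apply, ha, hb]
  add_mem' ha hb z := by
    rw [map_add, map_add, LinearMap.add_apply, LinearMap.add_apply, map_add, ha, hb]
  algebraMap_mem' c z := by
    rw [AlgHom.commutes, AlgHom.commutes, Module.algebraMap_end_apply,
      Module.algebraMap_end_apply, map_smul]

theorem mem_intertwined_of_mul_eq_one {ρ : A →ₐ[R] Module.End R V}
    {σ : A →ₐ[R] Module.End R W} {f : V →ₗ[R] W} {a b : A} (hab : a * b = 1) (hba : b * a = 1)
    (ha : a ∈ intertwined ρ σ f) : b ∈ intertwined ρ σ f := fun z => calc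
  f (ρ b z) = σ (b * a) (f (ρ b z)) := by rw [hba, map_one, Module.End.one_apply]
  _ = σ b (f (ρ (a * b) z)) := by
    rw [map_mul, Module.End.mul_apply, ← ha, map_mul, Module.End.mul_apply]
  _ = σ b (f z) := by rw [hab, map_one, Module.End.one_apply]

end

variable {I : Type*} [Fintype I] [DecidableEq I] {D : Datum I}

theorem adjoin_range_gen : Algebra.adjoin Qvt (Set.range (U.gen D)) = ⊤ := by
  have range_gen : Set.range (U.gen D) = U.mk D '' Set.range (FreeAlgebra.ι Qvt) :=
    Set.range_comp _ _
  rw [range_gen, ← AlgHom.map_adjoin, FreeAlgebra.adjoin_range_ι, Algebra.map_top,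
    AlgHom.range_eq_top]
  exact RingQuot.mkAlgHom_surjective Qvt (Rel D)

variable {M N : Type*} [AddCommGroup M] [Module Qvt M] [Module (U D) M]
  [IsScalarTower Qvt (U D) M] [AddCommGroup N] [Module Qvt N] [Module (U D) N]
  [IsScalarTower Qvt (U D) N]

theorem comm_tensorEnd (a : U D ⊗[Qvt] U D) (z : M ⊗[Qvt] N) :
    TensorProduct.comm Qvt M N (tensorEnd D M N a z) =
      tensorEnd D N M (TensorProduct.comm Qvt (U D) (U D) a) (TensorProduct.comm Qvt M N z) := by
  induction a with
  | zero => simp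
  | add a b ha hb => simp only [map_add, LinearMap.add_apply, ha, hb]
  | tmul a b =>
    induction z with
    | zero => simp
    | add z z' hz hz' => simp only [map_add, hz, hz']
    | tmul x y => rfl

section

variable (hM : IsWeightModule D M) (hN : IsWeightModule D N) (i : I)

theorem ftilde_K_tmul_K : ftilde hM hN ∘ₗ tensorEnd D M N (U.K D i ⊗ₜ U.K D i) =
    tensorEnd D M N (U.K D i ⊗ₜ U.K D i) ∘ₗ ftilde hM hN := by
  refine hM.ext_tmul hN fun l m x hx y hy => ?_
  rw [LinearMap.comp_apply, LinearMap.comp_apply, ftilde_tmul hM hN hx hy, map_smul,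
    tensorEnd_tmul, (mem_weightSpace.1 hx i).1, (mem_weightSpace.1 hy i).1,
    TensorProduct.smul_tmul_smul, map_smul, ftilde_tmul hM hN hx hy, smul_comm]

theorem ftilde_K'_tmul_K' : ftilde hM hN ∘ₗ tensorEnd D M N (U.K' D i ⊗ₜ U.K' D i) =
    tensorEnd D M N (U.K' D i ⊗ₜ U.K' D i) ∘ₗ ftilde hM hN := by
  refine hM.ext_tmul hN fun l m x hx y hy => ?_
  rw [LinearMap.comp_apply, LinearMap.comp_apply, ftilde_tmul hM hN hx hy, map_smul,
    tensorEnd_tmul, (mem_weightSpace.1 hx i).2, (mem_weightSpace.1 hy i).2,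
    TensorProduct.smul_tmul_smul, map_smul, ftilde_tmul hM hN hx hy, smul_comm]

end

namespace DualBases

variable (B : DualBases D) (hM : IsWeightModule D M) (hN : IsWeightModule D N) (i : I)

include B

theorem ftilde_one_tmul_E : ftilde hM hN ∘ₗ tensorEnd D M N (1 ⊗ₜ U.E D i) =
    tensorEnd D M N (U.K' D i ⊗ₜ U.E D i) ∘ₗ ftilde hM hN := by
  refine hM.ext_tmul hN fun l m x hx y hy => ?_
  have hEy := smul_mem_weightSpace_of_mem_E (letter_mem_wordSpan i) hy
  rw [LinearMap.comp_apply, LinearMap.comp_apply, tensorEnd_tmul, one_smul, ftilde_tmul hM hN hx hy,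
    ftilde_tmul hM hN hx hEy, map_smul, tensorEnd_tmul, (mem_weightSpace.1 hx i).2,
    ← TensorProduct.smul_tmul', smul_smul, B.fmap_eq, B.fmap_eq, D.brace_add_right, mul_inv]

theorem ftilde_E_tmul_K : ftilde hM hN ∘ₗ tensorEnd D M N (U.E D i ⊗ₜ U.K D i) =
    tensorEnd D M N (U.E D i ⊗ₜ 1) ∘ₗ ftilde hM hN := by
  refine hM.ext_tmul hN fun l m x hx y hy => ?_
  have hEx := smul_mem_weightSpace_of_mem_E (letter_mem_wordSpan i) hx
  rw [LinearMap.comp_apply, LinearMap.comp_apply, tensorEnd_tmul, ftilde_tmul hM hN hx hy,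
    (mem_weightSpace.1 hy i).1, TensorProduct.tmul_smul, map_smul, ftilde_tmul hM hN hEx hy,
    map_smul, tensorEnd_tmul, one_smul, smul_smul, B.fmap_eq, B.fmap_eq, D.brace_add_left, mul_inv,
    mul_left_comm, mul_inv_cancel₀ (D.brace_ne_zero _ _), mul_one]

theorem ftilde_F_tmul_one : ftilde hM hN ∘ₗ tensorEnd D M N (U.F D i ⊗ₜ 1) =
    tensorEnd D M N (U.F D i ⊗ₜ U.K D i) ∘ₗ ftilde hM hN := by
  refine hM.ext_tmul hN fun l m x hx y hy => ?_
  have hFx := smul_mem_weightSpace_of_mem_F (letter_mem_wordSpan i) hx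
  have brace_eq : D.brace l m = D.brace (l - sg i) m * D.brace (sg i) m := by
    rw [← D.brace_add_left, sub_add_cancel]
  rw [LinearMap.comp_apply, LinearMap.comp_apply, tensorEnd_tmul, ftilde_tmul hM hN hx hy,
    one_smul, ftilde_tmul hM hN hFx hy, map_smul, tensorEnd_tmul, (mem_weightSpace.1 hy i).1,
    TensorProduct.tmul_smul, smul_smul, B.fmap_eq, B.fmap_eq, brace_eq, mul_inv, mul_assoc,
    inv_mul_cancel₀ (D.brace_ne_zero _ _), mul_one]

theorem ftilde_K'_tmul_F : ftilde hM hN ∘ₗ tensorEnd D M N (U.K' D i ⊗ₜ U.F D i) =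
    tensorEnd D M N (1 ⊗ₜ U.F D i) ∘ₗ ftilde hM hN := by
  refine hM.ext_tmul hN fun l m x hx y hy => ?_
  have hFy := smul_mem_weightSpace_of_mem_F (letter_mem_wordSpan i) hy
  have brace_eq : D.brace l m = D.brace l (m - sg i) * D.brace l (sg i) := by
    rw [← D.brace_add_right, sub_add_cancel]
  rw [LinearMap.comp_apply, LinearMap.comp_apply, tensorEnd_tmul, ftilde_tmul hM hN hx hy,
    (mem_weightSpace.1 hx i).2, ← TensorProduct.smul_tmul', map_smul, ftilde_tmul hM hN hx hFy,
    map_smul, tensorEnd_tmul, one_smul, smul_smul, B.fmap_eq, B.fmap_eq, brace_eq, mul_inv,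
    mul_comm]

omit i

theorem mem_intertwined_Rmat {u : U D} {c : U D ⊗[Qvt] U D}
    (ftilde_comm : ftilde hN hM ∘ₗ tensorEnd D N M
      (TensorProduct.comm Qvt (U D) (U D) (comul D u)) = tensorEnd D N M c ∘ₗ ftilde hN hM)
    (thetaOp_comm : B.thetaOp N M * tensorEnd D N M c =
      tensorEnd D N M (comul D u) * B.thetaOp N M) :
    u ∈ intertwined (tensorAct D M N) (tensorAct D N M) (B.Rmat hM hN) := fun z => calc
  _ = B.thetaOp N M (ftilde hN hM (tensorEnd D N M
        (TensorProduct.comm Qvt (U D) (U D) (comul D u)) (TensorProduct.comm Qvt M N z))) :=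
    congrArg (fun w => B.thetaOp N M (ftilde hN hM w)) (comm_tensorEnd _ z)
  _ = B.thetaOp N M (tensorEnd D N M c (ftilde hN hM (TensorProduct.comm Qvt M N z))) :=
    congrArg (B.thetaOp N M) (LinearMap.congr_fun ftilde_comm _)
  _ = tensorEnd D N M (comul D u) (B.Rmat hM hN z) := LinearMap.congr_fun thetaOp_comm _

theorem bijective_Rmat (hfin : {l | weightSpace D N l ≠ ⊥}.Finite) :
    Function.Bijective (B.Rmat hM hN) :=
  ((Module.End.isUnit_iff _).1 (B.isUnit_thetaOp hN hfin)).comp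
    ((B.bijective_ftilde hN hM).comp (TensorProduct.comm Qvt M N).bijective)

section

variable (hfin : {l | weightSpace D N l ≠ ⊥}.Finite)
include hfin

theorem K_mem_intertwined_Rmat (i : I) :
    U.K D i ∈ intertwined (tensorAct D M N) (tensorAct D N M) (B.Rmat hM hN) := by
  have comul_K : comul D (U.K D i) = U.K D i ⊗ₜ U.K D i := comul_gen D (.K i)
  refine B.mem_intertwined_Rmat hM hN (c := U.K D i ⊗ₜ U.K D i) ?_ ?_
  · rw [comul_K, TensorProduct.comm_tmul, ftilde_K_tmul_K]
  · rw [comul_K]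
    exact B.thetaOp_commute hN hfin fun n => B.theta_mul_K n i

theorem K'_mem_intertwined_Rmat (i : I) :
    U.K' D i ∈ intertwined (tensorAct D M N) (tensorAct D N M) (B.Rmat hM hN) := by
  have comul_K' : comul D (U.K' D i) = U.K' D i ⊗ₜ U.K' D i := comul_gen D (.K' i)
  refine B.mem_intertwined_Rmat hM hN (c := U.K' D i ⊗ₜ U.K' D i) ?_ ?_
  · rw [comul_K', TensorProduct.comm_tmul, ftilde_K'_tmul_K']
  · rw [comul_K']
    exact B.thetaOp_commute hN hfin fun n => B.theta_mul_K' n i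

theorem E_mem_intertwined_Rmat (i : I) :
    U.E D i ∈ intertwined (tensorAct D M N) (tensorAct D N M) (B.Rmat hM hN) := by
  have comul_E : comul D (U.E D i) = U.E D i ⊗ₜ 1 + U.K D i ⊗ₜ U.E D i := comul_gen D (.E i)
  refine B.mem_intertwined_Rmat hM hN (c := U.E D i ⊗ₜ 1 + U.K' D i ⊗ₜ U.E D i) ?_ ?_
  · rw [comul_E, map_add, TensorProduct.comm_tmul, TensorProduct.comm_tmul, map_add, map_add,
      LinearMap.comp_add, LinearMap.add_comp, B.ftilde_one_tmul_E, B.ftilde_E_tmul_K, add_comm]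
  · rw [comul_E]
    exact B.thetaOp_relation hN hfin i (B.thetaZ_mul_E i)

theorem F_mem_intertwined_Rmat (i : I) :
    U.F D i ∈ intertwined (tensorAct D M N) (tensorAct D N M) (B.Rmat hM hN) := by
  have comul_F : comul D (U.F D i) = 1 ⊗ₜ U.F D i + U.F D i ⊗ₜ U.K' D i := comul_gen D (.F i)
  refine B.mem_intertwined_Rmat hM hN (c := 1 ⊗ₜ U.F D i + U.F D i ⊗ₜ U.K D i) ?_ ?_
  · rw [comul_F, map_add, TensorProduct.comm_tmul, TensorProduct.comm_tmul, map_add, map_add,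
      LinearMap.comp_add, LinearMap.add_comp, B.ftilde_F_tmul_one, B.ftilde_K'_tmul_F, add_comm]
  · rw [comul_F]
    exact B.thetaOp_relation hN hfin i (B.thetaZ_mul_F i)

theorem intertwined_Rmat_eq_top :
    intertwined (tensorAct D M N) (tensorAct D N M) (B.Rmat hM hN) = ⊤ := by
  rw [eq_top_iff, ← adjoin_range_gen, Algebra.adjoin_le_iff]
  rintro _ ⟨x, rfl⟩
  have hK := B.K_mem_intertwined_Rmat hM hN hfin
  have hK' := B.K'_mem_intertwined_Rmat hM hN hfin
  cases x with
  | K i => exact hK i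
  | K' i => exact hK' i
  | Kinv i => exact mem_intertwined_of_mul_eq_one (U.K_Kinv D i) (U.Kinv_K D i) (hK i)
  | K'inv i => exact mem_intertwined_of_mul_eq_one (U.K'_K'inv D i) (U.K'inv_K' D i) (hK' i)
  | E i => exact B.E_mem_intertwined_Rmat hM hN hfin i
  | F i => exact B.F_mem_intertwined_Rmat hM hN hfin i

end

end DualBases

end Intertwining

end TwoParam

end

open TwoParam in
theorem mainTheorem3_general {I : Type*} [Fintype I] [DecidableEq I] {D : Datum I}
    (B : DualBases D) {M M' : Type*}
    [AddCommGroup M] [Module Qvt M] [Module (U D) M] [IsScalarTower Qvt (U D) M]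
    [AddCommGroup M'] [Module Qvt M'] [Module (U D) M'] [IsScalarTower Qvt (U D) M']
    (hM : IsWeightModule D M) (hM' : IsWeightModule D M')
    (hfin : {l | weightSpace D M' l ≠ ⊥}.Finite) :
    {n : I → ℕ | tensorEnd D M' M (B.theta n) ≠ 0}.Finite ∧
    Function.Bijective (B.Rmat hM hM') ∧
    ∀ (u : U D) (z : TensorProduct Qvt M M'),
      B.Rmat hM hM' (tensorAct D M M' u z) = tensorAct D M' M u (B.Rmat hM hM' z) := by
  refine ⟨B.finite_theta hM' hfin, B.bijective_Rmat hM hM' hfin, fun u => ?_⟩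
  suffices u ∈ intertwined (tensorAct D M M') (tensorAct D M' M) (B.Rmat hM hM') from this
  rw [B.intertwined_Rmat_eq_top hM hM' hfin]
  exact Algebra.mem_top

open TwoParam in
theorem mainTheorem3 {I : Type*} [Fintype I] [DecidableEq I] (D : Datum I) (B : DualBases D)
    (M M' : Type*)
    [AddCommGroup M] [Module Qvt M] [Module (U D) M] [IsScalarTower Qvt (U D) M]
    [AddCommGroup M'] [Module Qvt M'] [Module (U D) M'] [IsScalarTower Qvt (U D) M']
    [FiniteDimensional Qvt M] [FiniteDimensional Qvt M']
    (hM : IsWeightModule D M) (hM' : IsWeightModule D M') :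
    {n : I → ℕ | tensorEnd D M' M (B.theta n) ≠ 0}.Finite ∧
    Function.Bijective (B.Rmat hM hM') ∧
    ∀ (u : U D) (z : TensorProduct Qvt M M'),
      B.Rmat hM hM' (tensorAct D M M' u z) = tensorAct D M' M u (B.Rmat hM hM' z) :=
  mainTheorem3_general B hM hM' hM'.finite_weights
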